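/- Let $\beta(x)=\frac{x}{e^x-1}=\sum_{j\ge0}\beta_jx^j$ (so $\beta_j=B_j/j!$) and $\tilde\beta(x)=\sum_{j\ge0}|\beta_j|x^j$. Define $\psi_0=0$ and, for $k\ge1$, $$k\,\psi_k=\sum_{s\ge0}\ \sum_{l_1+\dots+l_s=k-1}|\beta_s|\,\psi_{l_1}\cdots\psi_{l_s},\qquad \psi(x)=\sum_{k\ge0}\psi_kx^k .$$ Let the Magnus commutator $\mu_k=\mu_k(X_1,\dots,X_k)$ be the coefficient of $t_1\cdots t_k$ in $\log(\exp(t_1X_1)\cdots\exp(t_kX_k))$ (formal commuting parameters $t_i$, free noncommuting variables $X_i$), and let $\mu_k^{\mathrm{Lie}}$ be the element of the real free Lie algebra on $X_1,\dots,X_k$ whose image in the free associative algebra is $\mu_k$. Let $$\Theta_k^{\mathrm{Lie}}=\frac1{k!}\inf\Bigl\{\sum_\gamma|\theta_\gamma|\ :\ \mu_k^{\mathrm{Lie}}=\sum_\gamma\theta_\gamma\,\gamma,\ \theta_\gamma\in\mathbb R\Bigr\},$$ where $\gamma$ runs over the Lie monomials (iterated brackets) in $X_1,\dots,X_k$ containing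 every variable exactly once. Put $\Theta^{\mathrm{Lie}}(x)=\sum_{k\ge1}\Theta_k^{\mathrm{Lie}}x^k$, and let $\mathrm C_\infty^{\mathrm{Lie}}$ be its radius of convergence. Then: (a) For all complex $x$ with $|x|<2\pi$ the series $\tilde\beta(x)$ converges, and $\tilde\beta(x)=2+\frac x2-\frac x2\cot\frac x2$ (with value $1$ at the removable singularity $x=0$). (b) Formally, $\psi(0)=0$ and $\psi'=\tilde\beta(\psi)$. The function $1/\tilde\beta$ is integrable on $[0,2\pi]$; put $$\boldsymbol\delta=\int_0^{2\pi}\frac{dy}{\tilde\beta(y)}=2.1737374\ldots .$$ The power series $\psi$ has radius of convergence exactly $\boldsymbol\delta$; for complex $|x|<\boldsymbol\delta$ one has $|\psi(x)|<2\pi$ and $\psi'(x)=\tilde\beta(\psi(x))$, and $\psi(0)=0$. On $[0,\boldsymbol\delta)$ both $\psi$ and $\psi'$ are strictly increasing, and as $x\nearrow\boldsymbol\delta$, $\psi(x)\nearrow2\pi$ and $\psi'(x)\nearrow+\infty$. In terms of sums of series with nonnegative terms, $\sum_k\psi_k\boldsymbol\delta^k=2\pi$ and $\sum_k k\,\psi_k\boldsymbol\delta^{k-1}=+\infty$.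 (c) (Standard estimate.) For every $k$, a Lie polynomial $\mu_k^{\mathrm{Lie}}$ and a presentation of it as above exist, and $0\le\Theta_k^{\mathrm{Lie}}\le\psi_k$. Hence for $0\le x\le\boldsymbol\delta$ the series $\Theta^{\mathrm{Lie}}(x)$ converges and $\Theta^{\mathrm{Lie}}(x)\le\psi(x)$; in particular $\mathrm C_\infty^{\mathrm{Lie}}\ge\boldsymbol\delta$. -/

import Mathlib

open scoped Nat

attribute [local instance 100] LieRing.ofAssociativeRing

noncomputable section

/-! Magnus commutators -/

/-- The formal series `exp (tᵢ Xᵢ) = ∑ₙ tᵢⁿ Xᵢⁿ / n!`, in commuting formal parameters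
`t₁, …, t_k` that are central over the free associative algebra `ℝ⟨X₁, …, X_k⟩`. -/
def formalExpVar (k : ℕ) (i : Fin k) : MvPowerSeries (Fin k) (FreeAlgebra ℝ (Fin k)) :=
  fun m => if m = Finsupp.single i (m i) then
    (((m i)! : ℝ)⁻¹) • (FreeAlgebra.ι ℝ i) ^ (m i) else 0

/-- The formal logarithm `log f = ∑_{n ≥ 1} (-1)^(n+1) (f - 1)^n / n` of a formal series `f` with
constant term `1` (only the powers with `n ≤ |m|` contribute to the coefficient at `m`). -/
def formalLog {σ A : Type*} [Ring A] [Algebra ℝ A] (f : MvPowerSeries σ A) :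
    MvPowerSeries σ A :=
  fun m => ∑ n ∈ Finset.Icc 1 m.degree,
    ((-1 : ℝ) ^ (n + 1) / n) • MvPowerSeries.coeff m ((f - 1) ^ n)

/-- The Magnus commutator
`μ_k(X₁, …, X_k) = ∂^k / ∂t₁ ⋯ ∂t_k log (exp (t₁ X₁) ⋯ exp (t_k X_k)) |_{t = 0}`, that is the
coefficient of `t₁ ⋯ t_k`, an element of the free associative algebra. -/
def magnusCommutator (k : ℕ) : FreeAlgebra ℝ (Fin k) :=
  MvPowerSeries.coeff (Finsupp.equivFunOnFinite.symm (fun _ : Fin k => 1))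
    (formalLog (List.ofFn (formalExpVar k)).prod)

/-- The canonical map from the free Lie algebra to the free associative algebra
(with the commutator bracket). -/
def freeLieToFreeAlgebra (k : ℕ) : FreeLieAlgebra ℝ (Fin k) →ₗ⁅ℝ⁆ FreeAlgebra ℝ (Fin k) :=
  FreeLieAlgebra.lift ℝ (FreeAlgebra.ι ℝ)

/-- The Magnus commutator as a Lie polynomial `μ_k^Lie`: the element of the free Lie algebra whose
associative expansion is `μ_k`. -/
def magnusLie (k : ℕ) : FreeLieAlgebra ℝ (Fin k) :=
  Classical.epsilon fun L : FreeLieAlgebra ℝ (Fin k) => freeLieToFreeAlgebra k L = magnusCommutator k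

/-! The minimal presentations -/

/-- `IsLieMonomial s M`: `M` is a Lie monomial (iterated bracket of generators) in which the
variables occur with the multiplicities prescribed by the multiset `s`. -/
inductive IsLieMonomial {ι : Type*} : Multiset ι → FreeLieAlgebra ℝ ι → Prop
  | of (i : ι) : IsLieMonomial {i} (FreeLieAlgebra.of ℝ i)
  | lie {s t : Multiset ι} {M N : FreeLieAlgebra ℝ ι} :
      IsLieMonomial s M → IsLieMonomial t N → IsLieMonomial (s + t) ⁅M, N⁆

/-- The Lie monomials of `X₁, …, X_k` in which every variable has multiplicity `1`. -/
def lieMonomials (k : ℕ) : Set (FreeLieAlgebra ℝ (Fin k)) :=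
  {M | IsLieMonomial (Finset.univ : Finset (Fin k)).val M}

/-- The presentations `μ_k^Lie = ∑_γ θ_γ γ` by Lie monomials. -/
def magnusPresentations (k : ℕ) : Set (lieMonomials k →₀ ℝ) :=
  {θ | (θ.sum fun γ c => c • (γ : FreeLieAlgebra ℝ (Fin k))) = magnusLie k}

/-- `Θ_k^Lie`: `1 / k!` times the infimum of `∑_γ |θ_γ|` over the presentations of `μ_k^Lie`.
(For `k = 0` there are no Lie monomials and the value is `0`.) -/
def thetaLie (k : ℕ) : ℝ :=
  1 / (k ! : ℝ) *
    sInf ((fun θ : lieMonomials k →₀ ℝ => θ.sum fun _ c => |c|) '' magnusPresentations k)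

/-- The convergence radius `C_∞^Lie` of the power series `Θ^Lie(x) = ∑_k Θ_k^Lie x^k`. -/
def radiusLie : ENNReal := (FormalMultilinearSeries.ofScalars ℝ thetaLie).radius

/-! The majorant -/

/-- The coefficients `β_j = B_j / j!` of `x / (exp x - 1)`. -/
def magnusBeta (j : ℕ) : ℝ := (bernoulli j : ℝ) / (j ! : ℝ)

/-- The sum `β̃(x) = ∑_j |β_j| x^j`, for a real or complex `x`. -/
def betaTilde {𝕜 : Type*} [RCLike 𝕜] (x : 𝕜) : 𝕜 := ∑' j : ℕ, ((|magnusBeta j| : ℝ) : 𝕜) * x ^ j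

/-- The numbers `ψ_k` with `ψ_0 = 0` and
`k ψ_k = ∑_{l₁ + ⋯ + l_s = k - 1} |β_s| ψ_{l₁} ⋯ ψ_{l_s}`.
As `ψ_0 = 0`, only the tuples of positive `l_i`, i.e. the compositions of `k - 1`, matter. -/
def psiCoeff : ℕ → ℝ
  | 0 => 0
  | k + 1 => (∑ c : Composition k,
      |magnusBeta c.length| * ∏ i : Fin c.length, psiCoeff (c.blocksFun i)) / ((k : ℝ) + 1)
decreasing_by exact Nat.lt_succ_of_le (c.blocksFun_le i)

/-- The sum `ψ(x) = ∑_k ψ_k x^k`, for a real or complex `x`. -/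
def psiSum {𝕜 : Type*} [RCLike 𝕜] (x : 𝕜) : 𝕜 := ∑' k : ℕ, ((psiCoeff k : ℝ) : 𝕜) * x ^ k

/-- The constant `δ = ∫_0^{2π} dy / β̃(y)`. -/
def standardDelta : ℝ := ∫ y in (0 : ℝ)..(2 * Real.pi), 1 / betaTilde y

end

/-!
The logarithm. Work in the ring of series in central variables `t₁, …, t_k` with `tᵢ² = 0`; it
suffices for the coefficient of `t₁ ⋯ t_k`, and there `exp (tᵢ Xᵢ) = 1 + tᵢ Xᵢ`. The first-order
expansion of the exponential gives, for nilpotent `Ω`,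
`log ((1 + t X) exp Ω) = Ω + t β(ad Ω) X` (`nilEval_exp_add`). Multiplying the factors one after the
other, the coefficient of `∏_{i ∈ S} tᵢ` in the logarithm is a sum of iterated brackets
`β_s [μ_{I₁}, […, [μ_{I_s}, Xᵢ]]]` over the ordered partitions of `S \ {i}`. Counting the partitions
turns this into the recursion of `ψ`, so that these coefficients have presentations by Lie
monomials whose absolute sums are at most `|S|! ψ_{|S|}` (`exists_log_prod`).

These presentations are of *the* Lie polynomial `μ_k^Lie` because the free Lie algebra embeds into
the free associative algebra (`lieExpand_injective`). The Poincaré–Birkhoff–Witt theorem is not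
needed over the reals: bracketing the words of an associative expansion from the right multiplies
Lie monomials of degree `n` by `n` (the Dynkin–Specht–Wever argument), and the resulting operator on
the free Lie algebra is injective.

The series. Euler's formula `|β_{2k}| (2π)^{2k} = 2 ζ(2k)` gives the signs of the Bernoulli numbers,
the radius `2π` and the divergence of `β̃` at `2π`; by the signs, `β̃(z)` is expressed by
`w / (exp w - 1)` at `w = i z`, which is the closed form (`hasSum_abs_magnusBeta`).

The differential equation. Coefficientwise `ψ' = β̃(ψ)`, and all coefficients are nonnegative, so
the partial sums satisfy `S' ≤ β̃(S)`. With `F(y) = ∫₀ʸ du / β̃(u)` this says that `F(S(x)) ≤ x`, hence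
`S(x) < 2π` for `x < δ = F(2π)` (`psiPartial_lt_of_lt`), and `ψ` converges on `[0, δ]`. Rearranging
double series gives `ψ' = β̃(ψ)` analytically, so `F(ψ(x)) = x` (`betaTime_psiSum`), which yields
`ψ(δ) = 2π` and `ψ'(x) → ∞` as `x → δ`; the latter bounds the radius of convergence by `δ`.

The value of `δ`. On three intervals, `1 / β̃(2u) = (sin u / u) / ((2 + u) sin u / u - cos u)` is
compared with explicit polynomials `p`: the difference is controlled by the polynomial
`denominator * p - numerator`, with sine and cosine replaced by Taylor polynomials, and this is
bounded by the sum of the absolute values of its terms, in exact rational arithmetic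
(`standardDelta_bounds`).
-/

noncomputable section

/-! ### The free Lie algebra embeds into the free associative algebra -/

section FreeLie

variable {ι : Type*}

/-- The operator `(r, l) ↦ (0, r x + [x, l])` on `ℝ ⊕ L`. -/
def dynkinOperator {L : Type*} [LieRing L] [LieAlgebra ℝ L] (x : L) : Module.End ℝ (ℝ × L) :=
  LinearMap.prod 0 ((LinearMap.toSpanSingleton ℝ L x).comp (LinearMap.fst ℝ ℝ L) +
    (LieAlgebra.ad ℝ L x : L →ₗ[ℝ] L).comp (LinearMap.snd ℝ ℝ L))

lemma dynkinOperator_apply {L : Type*} [LieRing L] [LieAlgebra ℝ L] (x : L) (p : ℝ × L) :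
    dynkinOperator x p = (0, p.1 • x + ⁅x, p.2⁆) := rfl

/-- The action of the free associative algebra on `ℝ ⊕ L`, `L` the free Lie algebra, in which the
generators act by `dynkinOperator`. The second component of `w • (1, 0)` is the right-normed
bracket of the word `w`. -/
def dynkinRep (ι : Type*) : FreeAlgebra ℝ ι →ₐ[ℝ] Module.End ℝ (ℝ × FreeLieAlgebra ℝ ι) :=
  FreeAlgebra.lift ℝ fun i => dynkinOperator (FreeLieAlgebra.of ℝ i)

/-- The associative expansion of Lie polynomials in an arbitrary set of variables. -/
def lieExpand (ι : Type*) : FreeLieAlgebra ℝ ι →ₗ⁅ℝ⁆ FreeAlgebra ℝ ι :=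
  FreeLieAlgebra.lift ℝ (FreeAlgebra.ι ℝ)

lemma lieExpand_of (i : ι) : lieExpand ι (FreeLieAlgebra.of ℝ i) = FreeAlgebra.ι ℝ i := by
  simp [lieExpand]

/-- A Lie monomial of degree `n` acts on `(r, l)` by `(0, r n M + [M, l])`: the right-normed
bracketing multiplies Lie monomials by their degree. -/
lemma dynkinRep_lieMonomial {s : Multiset ι} {M : FreeLieAlgebra ℝ ι} (h : IsLieMonomial s M)
    (p : ℝ × FreeLieAlgebra ℝ ι) :
    dynkinRep ι (lieExpand ι M) p = (0, (p.1 * (s.card : ℝ)) • M + ⁅M, p.2⁆) := by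
  induction h generalizing p with
  | of i => simp [lieExpand_of, dynkinRep, dynkinOperator_apply]
  | @lie s t M N _ _ hM hN =>
    rw [LieHom.map_lie, LieRing.of_associative_ring_bracket, map_sub, map_mul, map_mul,
      LinearMap.sub_apply, Module.End.mul_apply, Module.End.mul_apply, hN, hM, hM, hN]
    simp only [Prod.mk_sub_mk, sub_zero, zero_mul, zero_smul, zero_add, lie_add, lie_smul,
      Multiset.card_add, Nat.cast_add, mul_add, add_smul, lie_lie]
    rw [← lie_skew M N]
    congr 1
    module

/-- The Lie monomials span the free Lie algebra. -/
lemma span_lieMonomial (L : FreeLieAlgebra ℝ ι) :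
    L ∈ Submodule.span ℝ {M | ∃ s, IsLieMonomial (ι := ι) s M} := by
  let S : Submodule ℝ (FreeLieAlgebra ℝ ι) := Submodule.span ℝ {M | ∃ s, IsLieMonomial s M}
  have hlie : ∀ {x y}, x ∈ S → y ∈ S → ⁅x, y⁆ ∈ S := by
    intro x y hx hy
    induction hx using Submodule.span_induction with
    | mem x hx =>
      obtain ⟨s, hx⟩ := hx
      induction hy using Submodule.span_induction with
      | mem y hy =>
        obtain ⟨t, hy⟩ := hy
        exact Submodule.subset_span ⟨_, hx.lie hy⟩
      | zero => simp
      | add y z _ _ hy hz => rw [lie_add]; exact S.add_mem hy hz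
      | smul c y _ hy => rw [lie_smul]; exact S.smul_mem _ hy
    | zero => simp
    | add x z _ _ hx hz => rw [add_lie]; exact S.add_mem hx hz
    | smul c x _ hx => rw [smul_lie]; exact S.smul_mem _ hx
  let K : LieSubalgebra ℝ (FreeLieAlgebra ℝ ι) := { S with lie_mem' := hlie }
  -- the inclusion of the span retracts onto the identity by the universal property
  let f : FreeLieAlgebra ℝ ι →ₗ⁅ℝ⁆ K :=
    FreeLieAlgebra.lift ℝ fun i => ⟨FreeLieAlgebra.of ℝ i, Submodule.subset_span ⟨_, .of i⟩⟩
  have hf : K.incl.comp f = LieHom.id := by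
    ext i
    simp [f]
  have := (f L).2
  rwa [show ((f L : K) : FreeLieAlgebra ℝ ι) = L from LieHom.congr_fun hf L] at this

/-- The Dynkin–Specht–Wever map on the free Lie algebra: expand, then bracket right-normed. -/
def dynkinMap (ι : Type*) : FreeLieAlgebra ℝ ι →ₗ[ℝ] FreeLieAlgebra ℝ ι :=
  (LinearMap.snd ℝ ℝ _).comp ((LinearMap.applyₗ ((1, 0) : ℝ × FreeLieAlgebra ℝ ι)).comp
    ((dynkinRep ι).toLinearMap.comp (lieExpand ι : FreeLieAlgebra ℝ ι →ₗ[ℝ] FreeAlgebra ℝ ι)))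

lemma dynkinMap_apply (L : FreeLieAlgebra ℝ ι) :
    dynkinMap ι L = (dynkinRep ι (lieExpand ι L) (1, 0)).2 := rfl

lemma IsLieMonomial.card_pos {s : Multiset ι} {M : FreeLieAlgebra ℝ ι} (h : IsLieMonomial s M) :
    0 < s.card := by
  induction h with
  | of i => simp
  | lie _ _ h _ => rw [Multiset.card_add]; omega

/-- The Dynkin–Specht–Wever map acts on Lie monomials of degree `n` as multiplication by `n ≠ 0`,
and the Lie monomials span. -/
lemma ker_dynkinMap (L : FreeLieAlgebra ℝ ι) (h : dynkinMap ι L = 0) : L = 0 := by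
  classical
  -- `L` is a sum of eigenvectors of the Dynkin map with distinct positive eigenvalues
  let V : ℝ → Submodule ℝ (FreeLieAlgebra ℝ ι) := fun μ => Module.End.eigenspace (dynkinMap ι) μ
  have hind : iSupIndep V := Module.End.eigenspaces_iSupIndep (dynkinMap ι)
  have hmem : L ∈ ⨆ μ ∈ {μ : ℝ | μ ≠ 0}, V μ := by
    refine Submodule.span_le.2 ?_ (span_lieMonomial L)
    rintro M ⟨s, hM⟩
    have hs : (s.card : ℝ) ≠ 0 := by exact_mod_cast hM.card_pos.ne'
    refine (le_iSup₂_of_le (f := fun μ (_ : μ ∈ {μ : ℝ | μ ≠ 0}) => V μ) (s.card : ℝ) hs le_rfl) ?_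
    change _ ∈ Module.End.eigenspace _ _
    rw [Module.End.mem_eigenspace_iff, dynkinMap_apply, dynkinRep_lieMonomial hM]
    simp
  have h0 : L ∈ V 0 := by
    change _ ∈ Module.End.eigenspace _ _
    rw [Module.End.mem_eigenspace_iff, h, zero_smul]
  exact (Submodule.disjoint_def.1 (hind 0)) L h0 (by simpa using hmem)

/-- The free Lie algebra embeds into the free associative algebra: the Dynkin map depends on the
associative expansion only. -/
lemma lieExpand_injective : Function.Injective (lieExpand ι) := by
  refine (injective_iff_map_eq_zero _).2 fun L hL => ker_dynkinMap L ?_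
  rw [dynkinMap_apply, hL]
  simp

end FreeLie

/-! ### Bounds for presentations by Lie monomials -/

section Bound

variable {ι : Type*}

/-- `HasLieBound s L c`: `L` is a linear combination of Lie monomials with multiplicities `s`
whose coefficients have absolute values of sum at most `c`. -/
inductive HasLieBound (s : Multiset ι) : FreeLieAlgebra ℝ ι → ℝ → Prop
  | monomial {M : FreeLieAlgebra ℝ ι} : IsLieMonomial s M → HasLieBound s M 1
  | zero : HasLieBound s 0 0
  | add {L L' : FreeLieAlgebra ℝ ι} {c c' : ℝ} :
      HasLieBound s L c → HasLieBound s L' c' → HasLieBound s (L + L') (c + c')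
  | smul (r : ℝ) {L : FreeLieAlgebra ℝ ι} {c : ℝ} :
      HasLieBound s L c → HasLieBound s (r • L) (|r| * c)
  | mono {L : FreeLieAlgebra ℝ ι} {c c' : ℝ} : HasLieBound s L c → c ≤ c' → HasLieBound s L c'

lemma HasLieBound.lie {s t : Multiset ι} {L L' : FreeLieAlgebra ℝ ι} {c c' : ℝ}
    (h : HasLieBound s L c) (h' : HasLieBound t L' c') (hc' : 0 ≤ c') :
    HasLieBound (s + t) ⁅L, L'⁆ (c * c') := by
  induction h with
  | @monomial M hM =>
    rw [one_mul]
    clear hc'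
    induction h' with
    | monomial hN => exact .monomial (hM.lie hN)
    | zero => rw [lie_zero]; exact .zero
    | add _ _ h1 h2 => rw [lie_add]; exact h1.add h2
    | smul r _ h1 => rw [lie_smul]; exact h1.smul r
    | mono _ hle h1 => exact h1.mono hle
  | zero => rw [zero_lie, zero_mul]; exact .zero
  | add _ _ h1 h2 => rw [add_lie, add_mul]; exact h1.add h2
  | smul r _ h1 => rw [smul_lie, mul_assoc]; exact h1.smul r
  | mono _ hle h1 => exact h1.mono (mul_le_mul_of_nonneg_right hle hc')

lemma HasLieBound.sum {s : Multiset ι} {α : Type*} (A : Finset α) {L : α → FreeLieAlgebra ℝ ι}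
    {c : α → ℝ} (h : ∀ a ∈ A, HasLieBound s (L a) (c a)) :
    HasLieBound s (∑ a ∈ A, L a) (∑ a ∈ A, c a) := by
  classical
  induction A using Finset.induction_on with
  | empty => simpa using .zero
  | insert a A ha ih =>
    rw [Finset.sum_insert ha, Finset.sum_insert ha]
    exact (h a (Finset.mem_insert_self a A)).add
      (ih fun b hb => h b (Finset.mem_insert_of_mem hb))

/-- The `ℓ¹`-norm of the coefficients is subadditive. -/
lemma finsupp_sum_abs_add_le {α : Type*} (θ θ' : α →₀ ℝ) :
    ((θ + θ').sum fun _ c => |c|) ≤ (θ.sum fun _ c => |c|) + θ'.sum fun _ c => |c| := by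
  classical
  rw [Finsupp.sum_of_support_subset θ (Finset.subset_union_left (s₂ := θ'.support)) _ (by simp),
    Finsupp.sum_of_support_subset θ' (Finset.subset_union_right (s₁ := θ.support)) _ (by simp),
    Finsupp.sum_of_support_subset (θ + θ') Finsupp.support_add _ (by simp),
    ← Finset.sum_add_distrib]
  exact Finset.sum_le_sum fun a _ => by simpa using abs_add_le (θ a) (θ' a)

lemma HasLieBound.exists_presentation {s : Multiset ι} {L : FreeLieAlgebra ℝ ι} {c : ℝ}
    (h : HasLieBound s L c) :
    ∃ θ : {M | IsLieMonomial s M} →₀ ℝ,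
      (θ.sum fun γ r => r • (γ : FreeLieAlgebra ℝ ι)) = L ∧ (θ.sum fun _ r => |r|) ≤ c := by
  classical
  induction h with
  | @monomial M hM =>
    refine ⟨Finsupp.single ⟨M, hM⟩ 1, ?_, ?_⟩ <;> simp [Finsupp.sum_single_index]
  | zero => exact ⟨0, by simp, by simp⟩
  | add _ _ h1 h2 =>
    obtain ⟨θ, rfl, hθ⟩ := h1
    obtain ⟨θ', rfl, hθ'⟩ := h2
    refine ⟨θ + θ', Finsupp.sum_add_index' (by simp) (by simp [add_smul]), ?_⟩
    exact (finsupp_sum_abs_add_le θ θ').trans (add_le_add hθ hθ')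
  | smul r _ h1 =>
    obtain ⟨θ, rfl, hθ⟩ := h1
    refine ⟨r • θ, ?_, ?_⟩
    · rw [Finsupp.sum_smul_index (by simp), Finsupp.smul_sum]
      simp [mul_smul]
    · rw [Finsupp.sum_smul_index (by simp)]
      simp only [abs_mul]
      rw [← Finsupp.mul_sum]
      exact mul_le_mul_of_nonneg_left hθ (abs_nonneg r)
  | mono _ hle h1 =>
    obtain ⟨θ, h2, hθ⟩ := h1
    exact ⟨θ, h2, hθ.trans hle⟩

end Bound

/-! ### Power series evaluated at nilpotent elements -/

section NilEval

open PowerSeries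

variable {R : Type*} [Ring R] [Algebra ℝ R]

/-- The value at `x` of the power series `p` truncated below degree `N`. It is multiplicative
in `p` when `x ^ N = 0`. -/
def nilEval (N : ℕ) (x : R) (p : ℝ⟦X⟧) : R := ∑ n ∈ Finset.range N, coeff n p • x ^ n

lemma nilEval_eq_aeval (N : ℕ) (x : R) (p : ℝ⟦X⟧) :
    nilEval N x p = Polynomial.aeval x (trunc N p) := by
  rw [nilEval, trunc_apply, map_sum, Nat.Ico_zero_eq_range]
  refine Finset.sum_congr rfl fun n _ => ?_
  rw [Polynomial.aeval_monomial, Algebra.smul_def]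

lemma nilEval_of_le {N M : ℕ} {x : R} (hx : x ^ N = 0) (h : N ≤ M) (p : ℝ⟦X⟧) :
    nilEval M x p = nilEval N x p := by
  refine (Finset.sum_subset (Finset.range_mono h) fun n _ hn => ?_).symm
  rw [pow_eq_zero_of_le (by simpa using hn) hx, smul_zero]

lemma nilEval_coe {N : ℕ} {x : R} (hx : x ^ N = 0) (q : Polynomial ℝ) :
    nilEval N x (q : ℝ⟦X⟧) = Polynomial.aeval x q := by
  rw [Polynomial.aeval_eq_sum_range' (n := max N (q.natDegree + 1)) (by omega),
    ← nilEval_of_le hx (le_max_left N (q.natDegree + 1)), nilEval]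
  simp

lemma nilEval_add (N : ℕ) (x : R) (p q : ℝ⟦X⟧) :
    nilEval N x (p + q) = nilEval N x p + nilEval N x q := by
  simp [nilEval, add_smul, Finset.sum_add_distrib]

lemma nilEval_smul (N : ℕ) (x : R) (c : ℝ) (p : ℝ⟦X⟧) :
    nilEval N x (c • p) = c • nilEval N x p := by
  simp [nilEval, mul_smul, Finset.smul_sum]

lemma nilEval_mul {N : ℕ} {x : R} (hx : x ^ N = 0) (p q : ℝ⟦X⟧) :
    nilEval N x (p * q) = nilEval N x p * nilEval N x q := by
  rw [nilEval_eq_aeval N x p, nilEval_eq_aeval N x q, ← map_mul, ← nilEval_coe hx,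
    nilEval_eq_aeval, nilEval_eq_aeval, Polynomial.coe_mul, trunc_trunc_mul_trunc]

lemma nilEval_one {N : ℕ} {x : R} (hx : x ^ N = 0) : nilEval N x 1 = 1 := by
  simpa using nilEval_coe hx 1

/-- Evaluation of power series at a nilpotent element. -/
def nilEvalHom {N : ℕ} {x : R} (hx : x ^ N = 0) : ℝ⟦X⟧ →ₐ[ℝ] R :=
  AlgHom.ofLinearMap ⟨⟨nilEval N x, nilEval_add N x⟩, nilEval_smul N x⟩ (nilEval_one hx)
    (nilEval_mul hx)

lemma nilEvalHom_apply {N : ℕ} {x : R} (hx : x ^ N = 0) (p : ℝ⟦X⟧) :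
    nilEvalHom hx p = nilEval N x p := rfl

lemma nilEval_X {N : ℕ} {x : R} (hx : x ^ N = 0) : nilEval N x X = x := by
  simpa using nilEval_coe hx Polynomial.X

lemma X_pow_dvd_exp_sub_one_pow (k : ℕ) : (X : ℝ⟦X⟧) ^ k ∣ (exp ℝ - 1) ^ k :=
  pow_dvd_pow_of_dvd (X_dvd_iff.2 (by simp)) k

/-- The truncated logarithm series of `exp X` agrees with `X` up to degree `k`. -/
lemma coeff_log_exp (k n : ℕ) (hn : n ≤ k) :
    coeff n (∑ j ∈ Finset.Icc 1 k, ((-1 : ℝ) ^ (j + 1) / j) • (exp ℝ - 1) ^ j) =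
      coeff n (X : ℝ⟦X⟧) := by
  set g : ℝ⟦X⟧ := exp ℝ - 1 with hg
  have hg' : derivative ℝ g = 1 + g := by simp [hg, derivative_exp]
  -- the derivative of the logarithm series is a geometric series
  have hd : derivative ℝ (∑ j ∈ Finset.Icc 1 k, ((-1 : ℝ) ^ (j + 1) / j) • g ^ j) =
      1 - (-g) ^ k := by
    have h1 : ∀ j ∈ Finset.range k,
        derivative ℝ (((-1 : ℝ) ^ (j + 1 + 1) / ((j + 1 : ℕ) : ℝ)) • g ^ (j + 1)) =
          (-g) ^ j * (1 + g) := by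
      intro j _
      rw [Derivation.map_smul, derivative_pow, hg', Nat.add_sub_cancel, smul_eq_C_mul]
      have h2 : (C ((-1 : ℝ) ^ (j + 1 + 1) / ((j + 1 : ℕ) : ℝ)) : ℝ⟦X⟧) * ((j + 1 : ℕ) : ℝ⟦X⟧) =
          (-1) ^ j := by
        rw [← map_natCast (C (R := ℝ)), ← map_mul, div_mul_cancel₀ _ (by positivity)]
        simp [pow_succ]
      calc _ = (C ((-1 : ℝ) ^ (j + 1 + 1) / ((j + 1 : ℕ) : ℝ)) * ((j + 1 : ℕ) : ℝ⟦X⟧)) *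
            g ^ j * (1 + g) := by ring
        _ = _ := by rw [h2, ← mul_pow, neg_one_mul]
    rw [map_sum, show Finset.Icc 1 k = Finset.Ico 1 (k + 1) from rfl,
      Finset.sum_Ico_eq_sum_range, Nat.add_sub_cancel]
    simp only [add_comm 1]
    rw [Finset.sum_congr rfl h1, ← Finset.sum_mul]
    have := mul_neg_geom_sum (-g) k
    rw [← this]
    ring
  rcases n with _ | n
  · have : constantCoeff g = 0 := by simp [hg]
    rw [coeff_zero_eq_constantCoeff_apply, coeff_zero_eq_constantCoeff_apply, map_sum]
    refine (Finset.sum_eq_zero fun j hj => ?_).trans (by simp)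
    have hj : j ≠ 0 := by have := (Finset.mem_Icc.1 hj).1; omega
    rw [smul_eq_C_mul, map_mul, map_pow, this, zero_pow hj, mul_zero]
  · have h0 : coeff n ((-g) ^ k) = 0 := by
      rw [neg_pow]
      exact X_pow_dvd_iff.1 ((X_pow_dvd_exp_sub_one_pow k).mul_left _) n (by omega)
    have h1 := congrArg (coeff n) hd
    rw [coeff_derivative, map_sub, h0, sub_zero] at h1
    have h2 : coeff n (derivative ℝ (X : ℝ⟦X⟧)) = coeff n (1 : ℝ⟦X⟧) := by simp
    rw [coeff_derivative] at h2
    exact mul_right_cancel₀ (by positivity : (n : ℝ) + 1 ≠ 0) (h1.trans h2.symm)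

/-- The finite logarithm sum inverts the exponential of a nilpotent element. -/
lemma log_nilEval_exp {k : ℕ} {x : R} (hx : x ^ (k + 1) = 0) :
    ∑ j ∈ Finset.Icc 1 k, ((-1 : ℝ) ^ (j + 1) / j) • (nilEval (k + 1) x (exp ℝ) - 1) ^ j = x := by
  have h : nilEval (k + 1) x (∑ j ∈ Finset.Icc 1 k, ((-1 : ℝ) ^ (j + 1) / j) • (exp ℝ - 1) ^ j) =
      nilEval (k + 1) x X := by
    refine Finset.sum_congr rfl fun n hn => ?_
    rw [coeff_log_exp k n (by have := Finset.mem_range.1 hn; omega)]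
  rw [nilEval_X hx] at h
  rw [← nilEvalHom_apply hx, map_sum] at h
  simpa only [map_smul, map_pow, map_sub, map_one, nilEvalHom_apply] using h

/-! ### Perturbation of the logarithm -/

/-- The operator `y ↦ a y - y a`. -/
def commutatorEnd (a : R) : Module.End ℝ R := LinearMap.mulLeft ℝ a - LinearMap.mulRight ℝ a

lemma commutatorEnd_apply (a y : R) : commutatorEnd a y = a * y - y * a := rfl

lemma commutatorEnd_mul_pow (a y : R) (n : ℕ) :
    commutatorEnd a (y * a ^ n) = commutatorEnd a y * a ^ n := by
  rw [commutatorEnd_apply, commutatorEnd_apply, sub_mul, mul_assoc y, mul_assoc y, ← pow_succ,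
    ← pow_succ', mul_assoc]

lemma isNilpotent_commutatorEnd {a : R} (h : IsNilpotent a) : IsNilpotent (commutatorEnd a) := by
  refine Commute.isNilpotent_sub (LinearMap.commute_mulLeft_right a a) ?_ ?_
  · exact (LinearMap.isNilpotent_mulLeft_iff ℝ a).2 h
  · exact (LinearMap.isNilpotent_mulRight_iff ℝ a).2 h

/-- The degree `n + 1` part of the derivative of the exponential at `a` in the direction `w`,
sorted by powers of the commutator with `a`. -/
def expDerivTerm (a w : R) (n : ℕ) : R :=
  ∑ p ∈ Finset.HasAntidiagonal.antidiagonal n,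
    (((p.1 + 1)! : ℝ)⁻¹ * (p.2 ! : ℝ)⁻¹) • ((commutatorEnd a ^ p.1) w * a ^ p.2)

lemma expDerivTerm_succ (a w : R) (n : ℕ) :
    ((n : ℝ) + 2) • expDerivTerm a w (n + 1) =
      a * expDerivTerm a w n + (((n + 1)! : ℝ)⁻¹) • (w * a ^ (n + 1)) := by
  have h1 : ((n : ℝ) + 2) • expDerivTerm a w (n + 1) =
      (∑ p ∈ Finset.HasAntidiagonal.antidiagonal (n + 1),
        ((p.1 ! : ℝ)⁻¹ * (p.2 ! : ℝ)⁻¹) • ((commutatorEnd a ^ p.1) w * a ^ p.2)) +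
      ∑ p ∈ Finset.HasAntidiagonal.antidiagonal (n + 1),
        ((p.2 : ℝ) * (((p.1 + 1)! : ℝ)⁻¹ * (p.2 ! : ℝ)⁻¹)) •
          ((commutatorEnd a ^ p.1) w * a ^ p.2) := by
    rw [expDerivTerm, Finset.smul_sum, ← Finset.sum_add_distrib]
    refine Finset.sum_congr rfl fun p hp => ?_
    rw [smul_smul, ← add_smul]
    congr 1
    have h2 : (n : ℝ) + 2 = (p.1 + 1) + p.2 := by
      have : p.1 + p.2 = n + 1 := by simpa using hp
      have : (p.1 : ℝ) + p.2 = n + 1 := by exact_mod_cast this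
      linarith
    rw [h2, add_mul, Nat.factorial_succ]
    push_cast
    field_simp
  have hA : (∑ p ∈ Finset.HasAntidiagonal.antidiagonal (n + 1),
        ((p.1 ! : ℝ)⁻¹ * (p.2 ! : ℝ)⁻¹) • ((commutatorEnd a ^ p.1) w * a ^ p.2)) =
      (((n + 1)! : ℝ)⁻¹) • (w * a ^ (n + 1)) + commutatorEnd a (expDerivTerm a w n) := by
    rw [Finset.Nat.sum_antidiagonal_succ, expDerivTerm, map_sum]
    congr 1
    · simp
    · refine Finset.sum_congr rfl fun p _ => ?_
      rw [map_smul, commutatorEnd_mul_pow, pow_succ', Module.End.mul_apply]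
  have hB : (∑ p ∈ Finset.HasAntidiagonal.antidiagonal (n + 1),
        ((p.2 : ℝ) * (((p.1 + 1)! : ℝ)⁻¹ * (p.2 ! : ℝ)⁻¹)) •
          ((commutatorEnd a ^ p.1) w * a ^ p.2)) = expDerivTerm a w n * a := by
    rw [Finset.Nat.sum_antidiagonal_succ', expDerivTerm, Finset.sum_mul]
    simp only [Nat.cast_zero, zero_mul, zero_smul, zero_add]
    refine Finset.sum_congr rfl fun p _ => ?_
    rw [smul_mul_assoc, mul_assoc, ← pow_succ]
    congr 1
    rw [Nat.factorial_succ p.2]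
    push_cast
    field_simp
  rw [h1, hA, hB, commutatorEnd_apply]
  abel

variable {t : R}

/-- First-order expansion of a power, where `t` is central of square zero. -/
lemma add_smul_pow_succ (ht : ∀ r, t * r = r * t) (ht2 : t * t = 0) (a w : R) (n : ℕ) :
    (a + t * w) ^ (n + 1) = a ^ (n + 1) + t * (((n + 1)! : ℝ) • expDerivTerm a w n) := by
  induction n with
  | zero => simp [expDerivTerm]
  | succ n ih =>
    rw [pow_succ', ih]
    have h := expDerivTerm_succ a w n
    have h3 : (((n + 1 + 1)! : ℝ)) • expDerivTerm a w (n + 1) =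
        a * (((n + 1)! : ℝ) • expDerivTerm a w n) + w * a ^ (n + 1) := by
      rw [Nat.factorial_succ (n + 1), Nat.cast_mul, mul_comm, mul_smul,
        show (((n + 1 + 1 : ℕ) : ℝ)) = (n : ℝ) + 2 by push_cast; ring, h, smul_add, smul_smul,
        mul_inv_cancel₀ (by positivity), one_smul, mul_smul_comm]
    rw [h3]
    generalize (((n + 1)! : ℝ)) • expDerivTerm a w n = D
    have h4 : t * w * (t * D) = 0 := by
      rw [ht w, mul_assoc, ← mul_assoc t, ht2, zero_mul, mul_zero]
    rw [add_mul, mul_add, mul_add, h4, add_zero, ← pow_succ', ← mul_assoc a t, ← ht a]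
    noncomm_ring

/-- The power series `(exp X - 1) / X`. -/
def expSubOneDiv : ℝ⟦X⟧ := PowerSeries.mk fun n => ((n + 1)! : ℝ)⁻¹

lemma mk_magnusBeta : PowerSeries.mk magnusBeta = bernoulliPowerSeries ℝ := by
  ext n
  simp [magnusBeta, bernoulliPowerSeries]

/-- The series `(exp X - 1) / X` and `β(X) = X / (exp X - 1)` are inverse to each other. -/
lemma expSubOneDiv_mul_magnusBeta : expSubOneDiv * PowerSeries.mk magnusBeta = 1 := by
  have h : (X : ℝ⟦X⟧) * expSubOneDiv = exp ℝ - 1 := by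
    ext n
    rcases n with _ | n
    · simp
    · simp [expSubOneDiv, coeff_succ_X_mul, coeff_one, coeff_exp]
  have h2 := bernoulliPowerSeries_mul_exp_sub_one ℝ
  rw [← h, ← mk_magnusBeta] at h2
  refine mul_left_cancel₀ (X_ne_zero (R := ℝ)) ?_
  rw [mul_one]
  nth_rewrite 2 [← h2]
  ring

/-- The derivative of the exponential at `a` is `w ↦ ((exp (ad a) - 1) / ad a) w * exp a`. -/
lemma sum_expDerivTerm {N M : ℕ} {a : R} (ha : a ^ N = 0) (hM : commutatorEnd a ^ M = 0) (w : R) :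
    ∑ n ∈ Finset.range (M + N), expDerivTerm a w n =
      nilEval M (commutatorEnd a) expSubOneDiv w * nilEval N a (exp ℝ) := by
  let f : ℕ × ℕ → R := fun p =>
    (((p.1 + 1)! : ℝ)⁻¹ * (p.2 ! : ℝ)⁻¹) • ((commutatorEnd a ^ p.1) w * a ^ p.2)
  have h1 : nilEval M (commutatorEnd a) expSubOneDiv w * nilEval N a (exp ℝ) =
      ∑ p ∈ Finset.range M ×ˢ Finset.range N, f p := by
    rw [nilEval, nilEval, LinearMap.sum_apply, Finset.sum_mul_sum, Finset.sum_product]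
    refine Finset.sum_congr rfl fun i _ => Finset.sum_congr rfl fun j _ => ?_
    rw [LinearMap.smul_apply, smul_mul_smul_comm]
    simp [f, expSubOneDiv, coeff_exp]
  rw [h1, ← Finset.sum_fiberwise_of_maps_to (t := Finset.range (M + N)) (g := fun p : ℕ × ℕ => p.1 + p.2)
    (by
      intro p hp
      simp only [Finset.mem_product, Finset.mem_range] at hp ⊢
      omega)]
  refine Finset.sum_congr rfl fun n _ => (Finset.sum_subset ?_ ?_).symm
  · intro p hp
    simpa using (Finset.mem_filter.1 hp).2
  · intro p hp hp'
    have hp : p.1 + p.2 = n := by simpa using hp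
    simp only [Finset.mem_filter, Finset.mem_product, Finset.mem_range, hp, and_true, not_and_or,
      not_lt] at hp'
    rcases hp' with h | h
    · rw [pow_eq_zero_of_le h hM]; simp
    · rw [pow_eq_zero_of_le h ha]; simp

/-- If `t` is central of square zero, then
`log ((1 + t X) exp a) = a + t β(ad a) X` with `β(x) = x / (exp x - 1)`. -/
lemma nilEval_exp_add {N M K : ℕ} {a : R} (ht : ∀ r, t * r = r * t) (ht2 : t * t = 0)
    (ha : a ^ N = 0) (hM : commutatorEnd a ^ M = 0) (x : R)
    (hK : (a + t * nilEval M (commutatorEnd a) (PowerSeries.mk magnusBeta) x) ^ K = 0) :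
    nilEval K (a + t * nilEval M (commutatorEnd a) (PowerSeries.mk magnusBeta) x) (exp ℝ) =
      (1 + t * x) * nilEval N a (exp ℝ) := by
  set w := nilEval M (commutatorEnd a) (PowerSeries.mk magnusBeta) x with hw
  have hx : nilEval M (commutatorEnd a) expSubOneDiv w = x := by
    rw [hw, ← Module.End.mul_apply, ← nilEval_mul hM, expSubOneDiv_mul_magnusBeta,
      nilEval_one hM, Module.End.one_apply]
  have h2 : ∀ n, ∑ j ∈ Finset.range (n + 1), coeff j (exp ℝ) • (a + t * w) ^ j =
      (∑ j ∈ Finset.range (n + 1), coeff j (exp ℝ) • a ^ j) +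
        t * ∑ j ∈ Finset.range n, expDerivTerm a w j := by
    intro n
    rw [Finset.sum_range_succ', Finset.sum_range_succ' (fun j => coeff j (exp ℝ) • a ^ j),
      Finset.mul_sum, add_right_comm, ← Finset.sum_add_distrib, pow_zero, pow_zero]
    congr 1
    refine Finset.sum_congr rfl fun j _ => ?_
    rw [add_smul_pow_succ ht ht2, smul_add, mul_smul_comm, smul_smul, coeff_exp]
    congr 1
    rw [show ((algebraMap ℚ ℝ) (1 / ((j + 1)! : ℚ)) * ((j + 1)! : ℝ)) = 1 by
      simp [Nat.factorial_ne_zero], one_smul]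
  have h3 := h2 (M + (N + K))
  change nilEval _ _ _ = nilEval _ _ _ + _ at h3
  rw [nilEval_of_le hK (by omega), nilEval_of_le ha (by omega),
    sum_expDerivTerm (N := N + K) (pow_eq_zero_of_le (by omega) ha) hM, hx,
    nilEval_of_le ha (M := N + K) (by omega)] at h3
  rw [h3]
  noncomm_ring

end NilEval

/-! ### The recursion for the majorant in terms of powers of its generating series -/

section PsiFormal

open PowerSeries

/-- Sums over compositions are sums over coefficients of powers, for a series without constant
term. -/
lemma sum_composition_eq_sum_coeff_pow (g F : ℕ → ℝ) (hg : g 0 = 0) (n : ℕ) :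
    ∑ c : Composition n, F c.length * ∏ i : Fin c.length, g (c.blocksFun i) =
      ∑ s ∈ Finset.range (n + 1), F s * coeff n ((PowerSeries.mk g) ^ s) := by
  classical
  have h1 : ∀ s, coeff n ((PowerSeries.mk g) ^ s) =
      ∑ l ∈ (Finset.finsuppAntidiag (Finset.univ : Finset (Fin s)) n).filter (∀ i, · i ≠ 0),
        ∏ i, g (l i) := by
    intro s
    have h2 : (PowerSeries.mk g) ^ s = ∏ _i : Fin s, PowerSeries.mk g := by simp
    rw [h2, coeff_prod]
    simp only [coeff_mk]
    refine (Finset.sum_filter_of_ne fun l _ hl i hi => hl ?_).symm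
    exact Finset.prod_eq_zero (Finset.mem_univ i) (by rw [hi, hg])
  simp_rw [h1, Finset.mul_sum]
  rw [Finset.sum_sigma']
  have hinj : Function.Injective
      (fun p : (Σ s : ℕ, (Fin s →₀ ℕ)) => (List.ofFn fun i => p.2 i : List ℕ)) := by
    rintro ⟨s, l⟩ ⟨s', l'⟩ h
    have hs : s = s' := by simpa using congrArg List.length h
    subst hs
    have h' := List.ofFn_injective h
    congr 1
    ext i
    exact congrFun h' i
  refine Finset.sum_bij (fun c _ => ⟨c.length, Finsupp.equivFunOnFinite.symm c.blocksFun⟩)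
    ?_ ?_ ?_ ?_
  · intro c _
    simp only [Finset.mem_sigma, Finset.mem_range, Finset.mem_filter, Finset.mem_finsuppAntidiag]
    refine ⟨Nat.lt_succ_of_le c.length_le, ⟨⟨?_, Finset.subset_univ _⟩, fun i => ?_⟩⟩
    · simp
    · exact (c.blocks_pos' i i.2).ne'
  · intro c _ c' _ h
    have := congrArg (fun p : (Σ s : ℕ, (Fin s →₀ ℕ)) => (List.ofFn fun i => p.2 i : List ℕ)) h
    refine Composition.ext ?_
    simpa [Composition.ofFn_blocksFun] using this
  · rintro ⟨s, l⟩ h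
    simp only [Finset.mem_sigma, Finset.mem_range, Finset.mem_filter,
      Finset.mem_finsuppAntidiag] at h
    refine ⟨⟨List.ofFn l, fun {i} hi => ?_, ?_⟩, Finset.mem_univ _, hinj ?_⟩
    · obtain ⟨j, rfl⟩ := (List.mem_ofFn' _ _).1 hi
      exact Nat.pos_of_ne_zero (h.2.2 j)
    · rw [List.sum_ofFn]; exact h.2.1.1
    · exact Composition.ofFn_blocksFun _
  · intro c _
    rfl

lemma psiCoeff_zero : psiCoeff 0 = 0 := by rw [psiCoeff]

/-- The generating series of the numbers `ψ_k`. -/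
def psiSeries : ℝ⟦X⟧ := PowerSeries.mk psiCoeff

/-- The defining recursion: `(n + 1) ψ_{n+1}` is the `n`-th coefficient of `∑ₛ |β_s| ψˢ`. -/
lemma psiCoeff_succ (n : ℕ) :
    ((n : ℝ) + 1) * psiCoeff (n + 1) =
      ∑ s ∈ Finset.range (n + 1), |magnusBeta s| * coeff n (psiSeries ^ s) := by
  rw [psiSeries, ← sum_composition_eq_sum_coeff_pow psiCoeff (fun s => |magnusBeta s|)
    psiCoeff_zero n, psiCoeff, mul_div_cancel₀ _ (by positivity)]

lemma psiCoeff_nonneg (n : ℕ) : 0 ≤ psiCoeff n := by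
  induction n using Nat.strong_induction_on with
  | _ n ih =>
    rcases n with _ | n
    · rw [psiCoeff_zero]
    · rw [psiCoeff]
      refine div_nonneg (Finset.sum_nonneg fun c _ => mul_nonneg (abs_nonneg _)
        (Finset.prod_nonneg fun i _ => ih _ (Nat.lt_succ_of_le (c.blocksFun_le i))))
        (by positivity)

lemma coeff_psiSeries_pow_nonneg (n s : ℕ) : 0 ≤ coeff n (psiSeries ^ s) := by
  induction s generalizing n with
  | zero => rw [pow_zero, coeff_one]; split_ifs <;> norm_num
  | succ s ih =>
    rw [pow_succ, coeff_mul]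
    refine Finset.sum_nonneg fun p _ => mul_nonneg (ih _) ?_
    rw [psiSeries, coeff_mk]
    exact psiCoeff_nonneg _

lemma coeff_psiSeries_pow_of_lt {n s : ℕ} (h : n < s) : coeff n (psiSeries ^ s) = 0 := by
  have : (X : ℝ⟦X⟧) ∣ psiSeries := X_dvd_iff.2 (by simp [psiSeries, psiCoeff_zero])
  exact X_pow_dvd_iff.1 (pow_dvd_pow_of_dvd this s) n h

lemma sum_coeff_psiSeries_pow_le (n M : ℕ) :
    ∑ s ∈ Finset.range M, |magnusBeta s| * coeff n (psiSeries ^ s) ≤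
      ((n : ℝ) + 1) * psiCoeff (n + 1) := by
  rw [psiCoeff_succ, Finset.sum_subset (Finset.range_mono (le_max_right M (n + 1)))]
  · exact Finset.sum_le_sum_of_subset_of_nonneg (Finset.range_mono (le_max_left _ _))
      fun s _ _ => mul_nonneg (abs_nonneg _) (coeff_psiSeries_pow_nonneg n s)
  · intro s _ hs
    rw [coeff_psiSeries_pow_of_lt (by simpa using hs), mul_zero]

lemma derivative_psiSeries :
    derivative ℝ psiSeries = (PowerSeries.mk fun j => |magnusBeta j|).subst psiSeries := by
  ext n
  have h0 : constantCoeff psiSeries = 0 := by simp [psiSeries, psiCoeff_zero]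
  rw [coeff_subst' (HasSubst.of_constantCoeff_zero' h0), coeff_derivative, mul_comm, psiSeries,
    coeff_mk, psiCoeff_succ, finsum_eq_sum_of_support_subset (s := Finset.range (n + 1))]
  · simp [psiSeries]
  · intro s hs
    by_contra h
    refine hs ?_
    change _ • coeff n (psiSeries ^ s) = 0
    rw [coeff_psiSeries_pow_of_lt (by simpa using h), smul_zero]

end PsiFormal

/-! ### Series modulo non-squarefree monomials -/

section SquarefreeSeries

variable {ι : Type*} [DecidableEq ι] {A : Type*} [Ring A]

/-- The exponent of the squarefree monomial `∏_{i ∈ S} tᵢ`. -/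
def sqfreeExp (S : Finset ι) : ι →₀ ℕ := Finsupp.indicator S fun _ _ => 1

lemma sqfreeExp_apply (S : Finset ι) (i : ι) : sqfreeExp S i = if i ∈ S then 1 else 0 := by
  simp [sqfreeExp, Finsupp.indicator_apply]

lemma sqfreeExp_inj {S T : Finset ι} : sqfreeExp S = sqfreeExp T ↔ S = T := by
  refine ⟨fun h => ?_, fun h => h ▸ rfl⟩
  ext i
  have := DFunLike.congr_fun h i
  rw [sqfreeExp_apply, sqfreeExp_apply] at this
  split_ifs at this <;> simp_all

lemma coeff_sqfreeExp_mul (S : Finset ι) (f g : MvPowerSeries ι A) :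
    MvPowerSeries.coeff (sqfreeExp S) (f * g) = ∑ T ∈ S.powerset,
      MvPowerSeries.coeff (sqfreeExp T) f * MvPowerSeries.coeff (sqfreeExp (S \ T)) g := by
  rw [MvPowerSeries.coeff_mul]
  symm
  refine Finset.sum_bij (fun T _ => (sqfreeExp T, sqfreeExp (S \ T))) ?_ ?_ ?_ ?_
  · intro T hT
    rw [Finset.mem_powerset] at hT
    rw [Finset.HasAntidiagonal.mem_antidiagonal]
    ext i
    have := @hT i
    simp only [Finsupp.add_apply, sqfreeExp_apply, Finset.mem_sdiff]
    split_ifs <;> simp_all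
  · intro T _ T' _ h
    exact sqfreeExp_inj.1 (Prod.ext_iff.1 h).1
  · rintro ⟨a, b⟩ h
    rw [Finset.HasAntidiagonal.mem_antidiagonal] at h
    have h' : ∀ i, a i + b i = if i ∈ S then 1 else 0 := fun i => by
      rw [← sqfreeExp_apply, ← h, Finsupp.add_apply]
    refine ⟨a.support, ?_, ?_⟩
    · rw [Finset.mem_powerset]
      intro i hi
      have := h' i
      have hi : a i ≠ 0 := by simpa using hi
      by_contra hS
      rw [if_neg hS] at this
      omega
    · ext i
      · have := h' i
        simp only [sqfreeExp_apply, Finsupp.mem_support_iff]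
        split_ifs at this ⊢ <;> omega
      · have := h' i
        simp only [sqfreeExp_apply, Finset.mem_sdiff, Finsupp.mem_support_iff]
        by_cases hS : i ∈ S <;> by_cases ha : a i = 0 <;> simp [hS, ha] at this ⊢ <;> omega
  · intro T _
    rfl

/-- The congruence on formal series which compares the coefficients of squarefree monomials. -/
def sqfreeCon (ι : Type*) [DecidableEq ι] (A : Type*) [Ring A] : RingCon (MvPowerSeries ι A) where
  r f g := ∀ S : Finset ι,
    MvPowerSeries.coeff (sqfreeExp S) f = MvPowerSeries.coeff (sqfreeExp S) g
  iseqv := ⟨fun _ _ => rfl, fun h S => (h S).symm, fun h h' S => (h S).trans (h' S)⟩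
  add' h h' S := by rw [map_add, map_add, h, h']
  mul' h h' S := by
    rw [coeff_sqfreeExp_mul, coeff_sqfreeExp_mul]
    exact Finset.sum_congr rfl fun T _ => by rw [h, h']

/-- The ring of formal series in central variables `tᵢ` of square zero. -/
abbrev SqfreeSeries (ι : Type*) [DecidableEq ι] (A : Type*) [Ring A] : Type _ :=
  (sqfreeCon ι A).Quotient

/-- The class of a formal series in the ring of series in variables of square zero. -/
def sqfreeMk : MvPowerSeries ι A →+* SqfreeSeries ι A := (sqfreeCon ι A).mk'

lemma sqfreeMk_surjective : Function.Surjective (sqfreeMk : MvPowerSeries ι A → _) :=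
  Quotient.mk''_surjective

/-- The variable `tᵢ`. -/
def sqfreeVar (i : ι) : SqfreeSeries ι A := sqfreeMk (MvPowerSeries.X i)

lemma sqfreeVar_comm (i : ι) (x : SqfreeSeries ι A) : sqfreeVar i * x = x * sqfreeVar i := by
  obtain ⟨f, rfl⟩ := sqfreeMk_surjective x
  rw [sqfreeVar, ← map_mul, ← map_mul, MvPowerSeries.X_mul]

variable [Algebra ℝ A]

/-- The coefficient of `∏_{i ∈ S} tᵢ`. -/
def sqfreeCoeff (S : Finset ι) : SqfreeSeries ι A →ₗ[ℝ] A where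
  toFun x := Quotient.liftOn' x (fun f => MvPowerSeries.coeff (sqfreeExp S) f) fun _ _ h => h S
  map_add' x y := by
    induction x using Quotient.inductionOn'
    induction y using Quotient.inductionOn'
    exact map_add _ _ _
  map_smul' r x := by
    induction x using Quotient.inductionOn'
    rfl

lemma sqfreeCoeff_mk (S : Finset ι) (f : MvPowerSeries ι A) :
    sqfreeCoeff S (sqfreeMk f) = MvPowerSeries.coeff (sqfreeExp S) f := rfl

lemma sqfreeSeries_ext {x y : SqfreeSeries ι A} (h : ∀ S, sqfreeCoeff S x = sqfreeCoeff S y) :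
    x = y := by
  obtain ⟨f, rfl⟩ := sqfreeMk_surjective x
  obtain ⟨g, rfl⟩ := sqfreeMk_surjective y
  exact Quotient.sound' h

lemma sqfreeCoeff_mul (S : Finset ι) (x y : SqfreeSeries ι A) :
    sqfreeCoeff S (x * y) =
      ∑ T ∈ S.powerset, sqfreeCoeff T x * sqfreeCoeff (S \ T) y := by
  obtain ⟨f, rfl⟩ := sqfreeMk_surjective x
  obtain ⟨g, rfl⟩ := sqfreeMk_surjective y
  rw [← map_mul]
  exact coeff_sqfreeExp_mul S f g

lemma sqfreeCoeff_var_mul (i : ι) (S : Finset ι) (x : SqfreeSeries ι A) :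
    sqfreeCoeff S (sqfreeVar i * x) = if i ∈ S then sqfreeCoeff (S.erase i) x else 0 := by
  obtain ⟨f, rfl⟩ := sqfreeMk_surjective x
  rw [sqfreeVar, ← map_mul, sqfreeCoeff_mk, MvPowerSeries.X, MvPowerSeries.coeff_monomial_mul,
    one_mul, sqfreeCoeff_mk]
  have h1 : Finsupp.single i 1 ≤ sqfreeExp S ↔ i ∈ S := by
    rw [Finsupp.single_le_iff, sqfreeExp_apply]
    split_ifs with h <;> simp [h]
  by_cases h : i ∈ S
  · rw [if_pos h, if_pos (h1.2 h)]
    congr 2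
    ext j
    simp only [Finsupp.tsub_apply, sqfreeExp_apply, Finset.mem_erase, Finsupp.single_apply]
    by_cases hj : i = j
    · subst hj; simp [h]
    · simp [hj, Ne.symm hj]
  · rw [if_neg h, if_neg (fun h' => h (h1.1 h'))]

lemma sqfreeVar_mul_self (i : ι) : (sqfreeVar i * sqfreeVar i : SqfreeSeries ι A) = 0 := by
  refine sqfreeSeries_ext fun S => ?_
  rw [sqfreeCoeff_var_mul, ← mul_one (sqfreeVar i), sqfreeCoeff_var_mul, map_zero]
  simp

lemma sqfreeCoeff_C (S : Finset ι) (a : A) :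
    sqfreeCoeff S (sqfreeMk (MvPowerSeries.C a)) = if S = ∅ then a else 0 := by
  rw [sqfreeCoeff_mk, MvPowerSeries.coeff_C]
  refine if_congr ?_ rfl rfl
  rw [← sqfreeExp_inj, show sqfreeExp (∅ : Finset ι) = 0 by ext; simp [sqfreeExp_apply]]

lemma sqfreeCoeff_pow_of_card_lt {x : SqfreeSeries ι A} (hx : sqfreeCoeff ∅ x = 0) (n : ℕ)
    (S : Finset ι) (h : S.card < n) : sqfreeCoeff S (x ^ n) = 0 := by
  induction n generalizing S with
  | zero => omega
  | succ n ih =>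
    rw [pow_succ', sqfreeCoeff_mul]
    refine Finset.sum_eq_zero fun T hT => ?_
    rcases T.eq_empty_or_nonempty with rfl | hT'
    · rw [hx, zero_mul]
    · rw [ih, mul_zero]
      have := Finset.card_sdiff_add_card_eq_card (Finset.mem_powerset.1 hT)
      have := hT'.card_pos
      omega

lemma sqfree_pow_eq_zero [Fintype ι] {x : SqfreeSeries ι A} (hx : sqfreeCoeff ∅ x = 0) :
    x ^ (Fintype.card ι + 1) = 0 :=
  sqfreeSeries_ext fun S => by
    rw [map_zero, sqfreeCoeff_pow_of_card_lt hx _ _ (Nat.lt_succ_of_le (Finset.card_le_univ S))]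

/-- Only the variables in `V` occur in `x`. -/
def SqfreeSupported (V : Finset ι) (x : SqfreeSeries ι A) : Prop :=
  ∀ S, ¬ S ⊆ V → sqfreeCoeff S x = 0

lemma SqfreeSupported.add {V : Finset ι} {x y : SqfreeSeries ι A} (hx : SqfreeSupported V x)
    (hy : SqfreeSupported V y) : SqfreeSupported V (x + y) := fun S hS => by
  rw [map_add, hx S hS, hy S hS, add_zero]

lemma SqfreeSupported.sub {V : Finset ι} {x y : SqfreeSeries ι A} (hx : SqfreeSupported V x)
    (hy : SqfreeSupported V y) : SqfreeSupported V (x - y) := fun S hS => by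
  rw [map_sub, hx S hS, hy S hS, sub_zero]

lemma SqfreeSupported.mul {V : Finset ι} {x y : SqfreeSeries ι A} (hx : SqfreeSupported V x)
    (hy : SqfreeSupported V y) : SqfreeSupported V (x * y) := fun S hS => by
  rw [sqfreeCoeff_mul]
  refine Finset.sum_eq_zero fun T hT => ?_
  by_cases h : T ⊆ V
  · rw [hy (S \ T), mul_zero]
    intro h'
    refine hS fun i hi => ?_
    by_cases hiT : i ∈ T
    · exact h hiT
    · exact h' (Finset.mem_sdiff.2 ⟨hi, hiT⟩)
  · rw [hx T h, zero_mul]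

end SquarefreeSeries

/-! ### The majorization of the Magnus commutators -/

section Majorization

open PowerSeries

variable {ι : Type*} [DecidableEq ι]

/-- The coefficient of `∏_{i ∈ S} tᵢ` in `f` is a Lie polynomial, presented by Lie monomials in the
variables `S` and `u` with coefficients of absolute sum at most `|S|! a_{|S|}`. -/
def LieDominated (u : Multiset ι) (f : SqfreeSeries ι (FreeAlgebra ℝ ι)) (a : ℕ → ℝ) : Prop :=
  ∀ S : Finset ι, ∃ L, lieExpand ι L = sqfreeCoeff S f ∧
    HasLieBound (S.val + u) L ((S.card ! : ℝ) * a S.card)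

/-- Brackets multiply the dominating series, because the number of splittings of `S` into parts of
sizes `m` and `n - m` is `n! / (m! (n - m)!)`. -/
lemma LieDominated.commutator {u : Multiset ι} {f g : SqfreeSeries ι (FreeAlgebra ℝ ι)}
    {p q : ℝ⟦X⟧} (hf : LieDominated 0 f fun n => coeff n p)
    (hg : LieDominated u g fun n => coeff n q) (hq : ∀ n, 0 ≤ coeff n q) :
    LieDominated u (commutatorEnd f g) fun n => coeff n (p * q) := by
  intro S
  choose L hL hLb using hf
  choose L' hL' hLb' using hg
  refine ⟨∑ T ∈ S.powerset, ⁅L T, L' (S \ T)⁆, ?_, ?_⟩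
  · have h1 : sqfreeCoeff S (g * f) =
        ∑ T ∈ S.powerset, sqfreeCoeff (S \ T) g * sqfreeCoeff T f := by
      rw [sqfreeCoeff_mul]
      refine Finset.sum_nbij' (fun T => S \ T) (fun T => S \ T) ?_ ?_ ?_ ?_ ?_
      · intro T _; simp
      · intro T _; simp
      · intro T hT; exact Finset.sdiff_sdiff_eq_self (Finset.mem_powerset.1 hT)
      · intro T hT; exact Finset.sdiff_sdiff_eq_self (Finset.mem_powerset.1 hT)
      · intro T hT
        rw [Finset.sdiff_sdiff_eq_self (Finset.mem_powerset.1 hT)]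
    rw [commutatorEnd_apply, map_sub, h1, sqfreeCoeff_mul, ← Finset.sum_sub_distrib, map_sum]
    refine Finset.sum_congr rfl fun T _ => ?_
    rw [LieHom.map_lie, hL, hL', LieRing.of_associative_ring_bracket]
  · have h2 : ((S.card ! : ℝ) * coeff S.card (p * q)) = ∑ T ∈ S.powerset,
        ((T.card ! : ℝ) * coeff T.card p) * (((S \ T).card ! : ℝ) * coeff (S \ T).card q) := by
      have h3 : ∀ T ∈ S.powerset,
          ((T.card ! : ℝ) * coeff T.card p) * (((S \ T).card ! : ℝ) * coeff (S \ T).card q) =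
          (fun m => ((m ! : ℝ) * coeff m p) * (((S.card - m)! : ℝ) * coeff (S.card - m) q))
            T.card := by
        intro T hT
        rw [Finset.card_sdiff_of_subset (Finset.mem_powerset.1 hT)]
      rw [Finset.sum_congr rfl h3, Finset.sum_powerset_apply_card
          fun m => ((m ! : ℝ) * coeff m p) * (((S.card - m)! : ℝ) * coeff (S.card - m) q), coeff_mul,
        Finset.Nat.sum_antidiagonal_eq_sum_range_succ_mk, Finset.mul_sum]
      refine Finset.sum_congr rfl fun m hm => ?_
      have hm : m ≤ S.card := Nat.lt_succ_iff.1 (Finset.mem_range.1 hm)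
      rw [nsmul_eq_mul, ← Nat.choose_mul_factorial_mul_factorial hm]
      push_cast
      ring
    rw [h2]
    refine HasLieBound.sum _ fun T hT => ?_
    have h4 : S.val + u = (T.val + 0) + ((S \ T).val + u) := by
      rw [add_zero, ← add_assoc]
      congr 1
      rw [Finset.sdiff_val, add_tsub_cancel_of_le (Finset.val_le_iff.2 (Finset.mem_powerset.1 hT))]
    rw [h4]
    exact (hLb T).lie (hLb' (S \ T)) (mul_nonneg (by positivity) (hq _))

lemma LieDominated.commutator_pow {i : ι} {f : SqfreeSeries ι (FreeAlgebra ℝ ι)}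
    (hf : LieDominated 0 f psiCoeff) (s : ℕ) :
    LieDominated {i} ((commutatorEnd f ^ s) (sqfreeMk (MvPowerSeries.C (FreeAlgebra.ι ℝ i))))
      fun n => coeff n (psiSeries ^ s) := by
  have hf' : LieDominated 0 f fun n => coeff n psiSeries := by simpa [psiSeries] using hf
  induction s with
  | zero =>
    intro S
    rw [pow_zero, Module.End.one_apply, sqfreeCoeff_C]
    by_cases hS : S = ∅
    · subst hS
      refine ⟨FreeLieAlgebra.of ℝ i, by simp [lieExpand_of], ?_⟩
      simpa using HasLieBound.monomial (IsLieMonomial.of i)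
    · refine ⟨0, by simp [hS], HasLieBound.zero.mono ?_⟩
      exact mul_nonneg (by positivity) (coeff_psiSeries_pow_nonneg _ _)
  | succ s ih =>
    have := hf'.commutator ih fun n => coeff_psiSeries_pow_nonneg n s
    rwa [← pow_succ', ← Module.End.mul_apply, ← pow_succ'] at this

/-- The series `β(ad f) Xᵢ` is dominated by the derivative of `ψ`. -/
lemma LieDominated.beta {i : ι} {f : SqfreeSeries ι (FreeAlgebra ℝ ι)}
    (hf : LieDominated 0 f psiCoeff) (M : ℕ) :
    LieDominated {i} (nilEval M (commutatorEnd f) (PowerSeries.mk magnusBeta)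
      (sqfreeMk (MvPowerSeries.C (FreeAlgebra.ι ℝ i))))
      fun n => ((n : ℝ) + 1) * psiCoeff (n + 1) := by
  intro S
  choose L hL hLb using fun s => hf.commutator_pow (i := i) s S
  refine ⟨∑ s ∈ Finset.range M, magnusBeta s • L s, ?_, ?_⟩
  · rw [nilEval, LinearMap.sum_apply, map_sum, map_sum]
    refine Finset.sum_congr rfl fun s _ => ?_
    rw [map_smul, hL, coeff_mk, LinearMap.smul_apply, map_smul]
  · refine (HasLieBound.sum _ fun s _ => (hLb s).smul (magnusBeta s)).mono ?_
    refine le_trans (le_of_eq ?_) (mul_le_mul_of_nonneg_left (sum_coeff_psiSeries_pow_le S.card M)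
      (by positivity))
    rw [Finset.mul_sum]
    exact Finset.sum_congr rfl fun s _ => by ring

/-- The logarithm of `∏ (1 + tᵢ Xᵢ)` (in the order of the list `l`) in the ring of series in
variables of square zero: its coefficients are Lie polynomials dominated by `ψ`. -/
lemma exists_log_prod [Fintype ι] (l : List ι) (hl : l.Nodup) :
    ∃ f : SqfreeSeries ι (FreeAlgebra ℝ ι), sqfreeCoeff ∅ f = 0 ∧
      nilEval (Fintype.card ι + 1) f (exp ℝ) =
        (l.map fun i => 1 + sqfreeVar i * sqfreeMk (MvPowerSeries.C (FreeAlgebra.ι ℝ i))).prod ∧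
      SqfreeSupported l.toFinset f ∧ LieDominated 0 f psiCoeff := by
  induction l with
  | nil =>
    refine ⟨0, by simp, ?_, fun S _ => by simp, fun S => ⟨0, by simp, HasLieBound.zero.mono ?_⟩⟩
    · simp [nilEval, Finset.sum_range_succ']
    · exact mul_nonneg (by positivity) (psiCoeff_nonneg _)
  | cons i l ih =>
    obtain ⟨hil, hl⟩ := List.nodup_cons.1 hl
    obtain ⟨f, hf0, hfe, hfs, hfd⟩ := ih hl
    have hfn := sqfree_pow_eq_zero hf0
    obtain ⟨M, hM⟩ := isNilpotent_commutatorEnd ⟨_, hfn⟩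
    set w := nilEval M (commutatorEnd f) (PowerSeries.mk magnusBeta)
      (sqfreeMk (MvPowerSeries.C (FreeAlgebra.ι ℝ i))) with hw
    have hwd : LieDominated {i} w fun n => ((n : ℝ) + 1) * psiCoeff (n + 1) := hfd.beta M
    have hws : SqfreeSupported l.toFinset w := by
      have h1 : ∀ s, SqfreeSupported l.toFinset
          ((commutatorEnd f ^ s) (sqfreeMk (MvPowerSeries.C (FreeAlgebra.ι ℝ i)))) := by
        intro s
        induction s with
        | zero =>
          intro S hS
          rw [pow_zero, Module.End.one_apply, sqfreeCoeff_C, if_neg]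
          rintro rfl
          exact hS (Finset.empty_subset _)
        | succ s ihs =>
          rw [pow_succ', Module.End.mul_apply, commutatorEnd_apply]
          exact (hfs.mul ihs).sub (ihs.mul hfs)
      intro S hS
      rw [hw, nilEval, LinearMap.sum_apply, map_sum]
      refine Finset.sum_eq_zero fun s _ => ?_
      rw [LinearMap.smul_apply, map_smul, h1 s S hS, smul_zero]
    have h0 : sqfreeCoeff ∅ (f + sqfreeVar i * w) = 0 := by
      rw [map_add, hf0, sqfreeCoeff_var_mul]; simp
    refine ⟨f + sqfreeVar i * w, h0, ?_, ?_, ?_⟩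
    · rw [hw, nilEval_exp_add (sqfreeVar_comm i) (sqfreeVar_mul_self i) hfn hM _
        (sqfree_pow_eq_zero h0), hfe, List.map_cons, List.prod_cons]
    · intro S hS
      rw [map_add, hfs, sqfreeCoeff_var_mul, zero_add]
      · split_ifs with hi
        · refine hws _ fun h => hS ?_
          rw [List.toFinset_cons, ← Finset.insert_erase hi]
          exact Finset.insert_subset_insert i h
        · rfl
      · exact fun h => hS (h.trans (by simp))
    · intro S
      rw [map_add, sqfreeCoeff_var_mul]
      split_ifs with hi
      · rw [hfs S fun h => hil (by simpa using h hi), zero_add]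
        obtain ⟨L, hL, hLb⟩ := hwd (S.erase i)
        refine ⟨L, hL, ?_⟩
        have h1 : S.card = (S.erase i).card + 1 := (Finset.card_erase_add_one hi).symm
        have h2 : S.val + 0 = (S.erase i).val + {i} := by
          rw [add_zero, Finset.erase_val, add_comm, Multiset.singleton_add,
            Multiset.cons_erase hi]
        rw [h2, h1, Nat.factorial_succ]
        refine hLb.mono (le_of_eq ?_)
        push_cast
        ring
      · rw [add_zero]
        exact hfd S

lemma sqfreeMk_formalExpVar (k : ℕ) (i : Fin k) :
    sqfreeMk (formalExpVar k i) =
      1 + sqfreeVar i * sqfreeMk (MvPowerSeries.C (FreeAlgebra.ι ℝ i)) := by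
  refine sqfreeSeries_ext fun S => ?_
  rw [map_add, sqfreeCoeff_var_mul, sqfreeCoeff_C, sqfreeCoeff_mk,
    show (1 : SqfreeSeries (Fin k) (FreeAlgebra ℝ (Fin k))) = sqfreeMk (MvPowerSeries.C 1) by simp,
    sqfreeCoeff_C]
  change (if sqfreeExp S = Finsupp.single i (sqfreeExp S i) then
    (((sqfreeExp S i)! : ℝ)⁻¹) • (FreeAlgebra.ι ℝ i) ^ (sqfreeExp S i) else 0) = _
  rw [sqfreeExp_apply]
  have hs : Finsupp.single i 1 = sqfreeExp {i} := by
    ext j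
    simp [sqfreeExp_apply, Finsupp.single_apply, eq_comm]
  have h0 : (0 : Fin k →₀ ℕ) = sqfreeExp ∅ := by ext j; simp [sqfreeExp_apply]
  by_cases hi : i ∈ S
  · have hS : S ≠ ∅ := by rintro rfl; simp at hi
    simp only [if_pos hi, hs, sqfreeExp_inj, if_neg hS]
    have : S = {i} ↔ S.erase i = ∅ := by
      rw [Finset.erase_eq_empty_iff]
      simp [hS]
    simp [this]
  · simp only [if_neg hi, Finsupp.single_zero, h0, sqfreeExp_inj]
    simp

/-- The Magnus commutator is a Lie polynomial with a presentation of absolute sum at most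
`k! ψ_k`. -/
lemma exists_magnusLie (k : ℕ) :
    ∃ L : FreeLieAlgebra ℝ (Fin k), freeLieToFreeAlgebra k L = magnusCommutator k ∧
      HasLieBound (Finset.univ : Finset (Fin k)).val L ((k ! : ℝ) * psiCoeff k) := by
  obtain ⟨f, hf0, hfe, -, hfd⟩ := exists_log_prod (List.finRange k) (List.nodup_finRange k)
  have hfn := sqfree_pow_eq_zero hf0
  rw [Fintype.card_fin] at hfe hfn
  have h1 : magnusCommutator k = sqfreeCoeff Finset.univ f := by
    have he : Finsupp.equivFunOnFinite.symm (fun _ : Fin k => 1) = sqfreeExp Finset.univ := by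
      ext j; simp [sqfreeExp_apply]
    have hdeg : (sqfreeExp (Finset.univ : Finset (Fin k))).degree = k := by
      rw [Finsupp.degree_eq_sum]
      simp [sqfreeExp_apply]
    rw [magnusCommutator, he]
    change (∑ n ∈ Finset.Icc 1 (sqfreeExp (Finset.univ : Finset (Fin k))).degree, _) = _
    rw [hdeg]
    have hY : sqfreeMk (List.ofFn (formalExpVar k)).prod = nilEval (k + 1) f (exp ℝ) := by
      rw [hfe, map_list_prod, List.ofFn_eq_map, List.map_map]
      congr 1
      refine List.map_congr_left fun i _ => ?_
      exact sqfreeMk_formalExpVar k i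
    conv_rhs => rw [← log_nilEval_exp hfn, map_sum, ← hY]
    refine Finset.sum_congr rfl fun n _ => ?_
    rw [map_smul, ← map_one sqfreeMk, ← map_sub, ← map_pow, sqfreeCoeff_mk]
  obtain ⟨L, hL, hLb⟩ := hfd Finset.univ
  refine ⟨L, hL.trans h1.symm, ?_⟩
  simpa using hLb

lemma magnusLie_spec (k : ℕ) : freeLieToFreeAlgebra k (magnusLie k) = magnusCommutator k := by
  obtain ⟨L, hL, -⟩ := exists_magnusLie k
  exact Classical.epsilon_spec (p := fun L => freeLieToFreeAlgebra k L = magnusCommutator k) ⟨L, hL⟩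

lemma exists_magnusPresentation (k : ℕ) :
    ∃ θ ∈ magnusPresentations k, (θ.sum fun _ c => |c|) ≤ (k ! : ℝ) * psiCoeff k := by
  obtain ⟨L, hL, hLb⟩ := exists_magnusLie k
  have : L = magnusLie k := lieExpand_injective (hL.trans (magnusLie_spec k).symm)
  obtain ⟨θ, hθ, hθb⟩ := hLb.exists_presentation
  exact ⟨θ, hθ.trans this, hθb⟩

lemma sum_abs_nonneg {α : Type*} (θ : α →₀ ℝ) : 0 ≤ θ.sum fun _ c => |c| :=
  Finset.sum_nonneg fun _ _ => abs_nonneg _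

lemma thetaLie_nonneg (k : ℕ) : 0 ≤ thetaLie k := by
  refine mul_nonneg (by positivity) (Real.sInf_nonneg ?_)
  rintro _ ⟨θ, -, rfl⟩
  exact sum_abs_nonneg θ

lemma thetaLie_le_psiCoeff (k : ℕ) : thetaLie k ≤ psiCoeff k := by
  obtain ⟨θ, hθ, hθb⟩ := exists_magnusPresentation k
  have h1 : sInf ((fun θ : lieMonomials k →₀ ℝ => θ.sum fun _ c => |c|) ''
      magnusPresentations k) ≤ (k ! : ℝ) * psiCoeff k := by
    refine (csInf_le (show BddBelow _ from ⟨0, ?_⟩) (Set.mem_image_of_mem _ hθ)).trans hθb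
    rintro _ ⟨θ, -, rfl⟩
    exact sum_abs_nonneg θ
  rw [thetaLie, div_mul_eq_mul_div, one_mul, div_le_iff₀ (by positivity), mul_comm]
  exact h1

end Majorization

/-! ### The series of absolute values of the Bernoulli coefficients -/

section Beta

open Filter Topology

/-- Euler's formula for `ζ(2k)`, in terms of the coefficients `β_j`. -/
lemma hasSum_zeta_magnusBeta {k : ℕ} (hk : k ≠ 0) :
    HasSum (fun n : ℕ => 1 / (n : ℝ) ^ (2 * k))
      ((-1) ^ (k + 1) * magnusBeta (2 * k) * (2 * Real.pi) ^ (2 * k) / 2) := by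
  convert hasSum_zeta_nat hk using 1
  have h2 : (2 : ℝ) ^ (2 * k) = 2 ^ (2 * k - 1) * 2 := by
    rw [← pow_succ]; congr 1; omega
  rw [magnusBeta, mul_pow, h2]
  ring

lemma one_le_zeta {k : ℕ} (hk : k ≠ 0) :
    1 ≤ (-1) ^ (k + 1) * magnusBeta (2 * k) * (2 * Real.pi) ^ (2 * k) / 2 := by
  have := le_hasSum (hasSum_zeta_magnusBeta hk) 1 fun n _ => by positivity
  simpa using this

lemma zeta_le_two {k : ℕ} (hk : k ≠ 0) :
    (-1) ^ (k + 1) * magnusBeta (2 * k) * (2 * Real.pi) ^ (2 * k) / 2 ≤ 2 := by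
  have h1 : (-1) ^ (k + 1) * magnusBeta (2 * k) * (2 * Real.pi) ^ (2 * k) / 2 ≤
      Real.pi ^ 2 / 6 := by
    refine hasSum_le (fun n => ?_) (hasSum_zeta_magnusBeta hk) hasSum_zeta_two
    rcases Nat.eq_zero_or_pos n with rfl | hn
    · simp [hk]
    · refine one_div_le_one_div_of_le (by positivity) (pow_le_pow_right₀ ?_ (by omega))
      exact_mod_cast hn
  have := Real.pi_lt_d2
  have := Real.pi_pos
  nlinarith

lemma abs_magnusBeta_even {k : ℕ} (hk : k ≠ 0) :
    |magnusBeta (2 * k)| = (-1) ^ (k + 1) * magnusBeta (2 * k) := by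
  have h1 := one_le_zeta hk
  have h2 : 0 < (-1) ^ (k + 1) * magnusBeta (2 * k) := by
    by_contra! h
    have := mul_nonpos_of_nonpos_of_nonneg h (show 0 ≤ (2 * Real.pi) ^ (2 * k) by positivity)
    linarith
  rw [← abs_of_pos h2, abs_mul, abs_pow, abs_neg, abs_one, one_pow, one_mul]

lemma magnusBeta_zero : magnusBeta 0 = 1 := by simp [magnusBeta]

lemma magnusBeta_one : magnusBeta 1 = -1 / 2 := by simp [magnusBeta, bernoulli_one]

lemma magnusBeta_odd {k : ℕ} (hk : k ≠ 0) : magnusBeta (2 * k + 1) = 0 := by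
  rw [magnusBeta, bernoulli_eq_zero_of_odd (odd_two_mul_add_one k) (by omega)]
  simp

lemma abs_magnusBeta_le (j : ℕ) : |magnusBeta j| ≤ 4 * ((2 * Real.pi)⁻¹) ^ j := by
  have hpi := Real.pi_pos
  have hpi4 := Real.pi_le_four
  rcases Nat.even_or_odd' j with ⟨k, rfl | rfl⟩
  · rcases eq_or_ne k 0 with rfl | hk
    · norm_num [magnusBeta_zero]
    · rw [abs_magnusBeta_even hk, inv_pow, ← div_eq_mul_inv, le_div_iff₀ (by positivity)]
      linarith [zeta_le_two hk]
  · rcases eq_or_ne k 0 with rfl | hk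
    · rw [mul_zero, zero_add, magnusBeta_one, pow_one, ← div_eq_mul_inv,
        le_div_iff₀ (by positivity), abs_of_neg (by norm_num)]
      linarith
    · rw [magnusBeta_odd hk, abs_zero]
      positivity

lemma summable_abs_magnusBeta {r : ℝ} (h0 : 0 ≤ r) (h : r < 2 * Real.pi) :
    Summable fun j => |magnusBeta j| * r ^ j := by
  have hpi := Real.pi_pos
  have h1 : (2 * Real.pi)⁻¹ * r < 1 := by
    rw [inv_mul_eq_div, div_lt_one (by positivity)]; exact h
  refine Summable.of_nonneg_of_le (fun j => by positivity) (fun j => ?_)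
    ((summable_geometric_of_lt_one (by positivity) h1).mul_left 4)
  calc |magnusBeta j| * r ^ j ≤ 4 * ((2 * Real.pi)⁻¹) ^ j * r ^ j := by
        gcongr; exact abs_magnusBeta_le j
    _ = _ := by rw [mul_pow]; ring

/-- The generating function of the Bernoulli coefficients on its disc of convergence. -/
lemma hasSum_magnusBeta {w : ℂ} (hw : ‖w‖ < 2 * Real.pi) (hw1 : Complex.exp w ≠ 1) :
    HasSum (fun j : ℕ => (magnusBeta j : ℂ) * w ^ j) (w / (Complex.exp w - 1)) := by
  have hs : Summable fun j : ℕ => ‖(magnusBeta j : ℂ) * w ^ j‖ := by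
    simpa using summable_abs_magnusBeta (norm_nonneg w) hw
  let e : ℕ → ℂ := fun n => ((PowerSeries.coeff n (PowerSeries.exp ℝ - 1) : ℝ) : ℂ) * w ^ n
  have he : HasSum e (Complex.exp w - 1) := by
    have h1 : HasSum (fun n : ℕ => w ^ n / (n ! : ℂ)) (Complex.exp w) := by
      rw [Complex.exp_eq_exp_ℂ]
      exact NormedSpace.expSeries_div_hasSum_exp w
    have h2 : HasSum (fun n : ℕ => if n = 0 then (1 : ℂ) else 0) 1 := hasSum_ite_eq 0 1
    refine (h1.sub h2).congr_fun fun n => ?_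
    rcases n with _ | n
    · simp [e]
    · simp [e, PowerSeries.coeff_exp, PowerSeries.coeff_one, div_eq_inv_mul]
  have hes : Summable fun n => ‖e n‖ := he.summable.norm
  have hprod := tsum_mul_tsum_eq_tsum_sum_antidiagonal_of_summable_norm hs hes
  have h3 : ∀ n, ∑ p ∈ Finset.HasAntidiagonal.antidiagonal n,
      ((magnusBeta p.1 : ℂ) * w ^ p.1) * e p.2 = if n = 1 then w else 0 := by
    intro n
    have h4 := congrArg (PowerSeries.coeff n) (bernoulliPowerSeries_mul_exp_sub_one ℝ)
    rw [← mk_magnusBeta, PowerSeries.coeff_mul, PowerSeries.coeff_X] at h4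
    calc _ = ((∑ p ∈ Finset.HasAntidiagonal.antidiagonal n,
          PowerSeries.coeff p.1 (PowerSeries.mk magnusBeta) *
            PowerSeries.coeff p.2 (PowerSeries.exp ℝ - 1) : ℝ) : ℂ) * w ^ n := by
          rw [Complex.ofReal_sum, Finset.sum_mul]
          refine Finset.sum_congr rfl fun p hp => ?_
          rw [← Finset.HasAntidiagonal.mem_antidiagonal.1 hp, pow_add, PowerSeries.coeff_mk]
          simp only [e]
          push_cast
          ring
      _ = _ := by
          rw [h4]
          split_ifs with h <;> simp [h]
  rw [he.tsum_eq, tsum_congr h3, tsum_ite_eq] at hprod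
  have h5 : Complex.exp w - 1 ≠ 0 := sub_ne_zero.2 hw1
  rw [← (eq_div_iff h5).2 hprod]
  exact hs.of_norm.hasSum

lemma exp_I_mul_ne_one {z : ℂ} (hz : ‖z‖ < 2 * Real.pi) (hz0 : z ≠ 0) :
    Complex.exp (Complex.I * z) ≠ 1 := by
  intro h
  obtain ⟨n, hn⟩ := Complex.exp_eq_one_iff.1 h
  have hz' : z = n * (2 * Real.pi) := by
    have : Complex.I * z = Complex.I * (n * (2 * Real.pi)) := by rw [hn]; ring
    exact mul_left_cancel₀ Complex.I_ne_zero this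
  have hn0 : n ≠ 0 := by rintro rfl; simp at hz'; exact hz0 hz'
  have h1 : (1 : ℝ) ≤ |(n : ℝ)| := by exact_mod_cast Int.one_le_abs hn0
  have h2 : ‖z‖ = |(n : ℝ)| * (2 * Real.pi) := by
    rw [hz', norm_mul, Complex.norm_intCast, norm_mul, Complex.norm_real, Real.norm_eq_abs,
      abs_of_pos Real.pi_pos]
    simp
  nlinarith [Real.pi_pos]

lemma hasSum_abs_magnusBeta {z : ℂ} (hz : ‖z‖ < 2 * Real.pi) :
    HasSum (fun j : ℕ => ((|magnusBeta j| : ℝ) : ℂ) * z ^ j)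
      (if z = 0 then 1 else 2 + z / 2 - z / 2 * Complex.cot (z / 2)) := by
  by_cases hz0 : z = 0
  · rw [if_pos hz0]
    subst hz0
    convert hasSum_single 0 fun j hj => ?_ using 1
    · simp [magnusBeta_zero]
    · simp [hj]
  rw [if_neg hz0]
  have he := exp_I_mul_ne_one hz hz0
  have h1 := hasSum_magnusBeta (w := Complex.I * z) (by simpa using hz) he
  have h2 : HasSum (fun j : ℕ => if j = 0 then (2 : ℂ) else 0) 2 := hasSum_ite_eq 0 2
  have h3 : HasSum (fun j : ℕ => if j = 1 then z / 2 - Complex.I * z / 2 else 0)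
    (z / 2 - Complex.I * z / 2) := hasSum_ite_eq 1 _
  have h7 := (h2.add h3).sub h1
  have h8 : 2 + z / 2 - z / 2 * Complex.cot (z / 2) =
      2 + (z / 2 - Complex.I * z / 2) - Complex.I * z / (Complex.exp (Complex.I * z) - 1) := by
    rw [Complex.cot_eq_exp_ratio, show 2 * Complex.I * (z / 2) = Complex.I * z by ring]
    have h4 : Complex.exp (Complex.I * z) - 1 ≠ 0 := sub_ne_zero.2 he
    have h5 : 1 - Complex.exp (Complex.I * z) ≠ 0 := sub_ne_zero.2 he.symm
    generalize Complex.exp (Complex.I * z) = E at *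
    have h6 : (E + 1) / (Complex.I * (1 - E)) = Complex.I * (E + 1) / (E - 1) := by
      rw [div_eq_div_iff (mul_ne_zero Complex.I_ne_zero h5) h4]
      linear_combination (E + 1) * (E - 1) * Complex.I_mul_I
    rw [h6]
    field_simp
    ring
  rw [h8]
  refine h7.congr_fun fun j => ?_
  -- the signs of the Bernoulli numbers are absorbed by the rotation `z ↦ i z`
  rcases Nat.even_or_odd' j with ⟨k, rfl | rfl⟩
  · rcases eq_or_ne k 0 with rfl | hk
    · simp [magnusBeta_zero]; norm_num
    · have hI : (Complex.I * z) ^ (2 * k) = (-1) ^ k * z ^ (2 * k) := by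
        rw [mul_pow, pow_mul Complex.I, Complex.I_sq]
      rw [abs_magnusBeta_even hk, hI, if_neg (by omega), if_neg (by omega)]
      push_cast
      ring
  · rcases eq_or_ne k 0 with rfl | hk
    · simp [magnusBeta_one]
      norm_num
      ring
    · rw [magnusBeta_odd hk, if_neg (by omega), if_neg (by omega)]
      simp

/-! ### Power series with nonnegative coefficients and the growth of `β̃` -/

lemma summable_mul_pow_of_le {a : ℕ → ℝ} (ha : ∀ n, 0 ≤ a n) {r : ℝ}
    (hr : Summable fun n => a n * r ^ n) {x : ℝ} (hx0 : 0 ≤ x) (hx : x ≤ r) :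
    Summable fun n => a n * x ^ n :=
  Summable.of_nonneg_of_le (fun n => mul_nonneg (ha n) (by positivity))
    (fun n => mul_le_mul_of_nonneg_left (pow_le_pow_left₀ hx0 hx n) (ha n)) hr

lemma continuousOn_tsum_mul_pow {a : ℕ → ℝ} (ha : ∀ n, 0 ≤ a n) {r : ℝ}
    (hr : Summable fun n => a n * r ^ n) :
    ContinuousOn (fun x : ℝ => ∑' n, a n * x ^ n) (Set.Icc 0 r) := by
  refine continuousOn_tsum (fun n => by fun_prop) hr fun n x hx => ?_
  rw [norm_mul, norm_pow, Real.norm_of_nonneg (ha n), Real.norm_of_nonneg hx.1]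
  exact mul_le_mul_of_nonneg_left (pow_le_pow_left₀ hx.1 hx.2 n) (ha n)

lemma tsum_mul_pow_lt {a : ℕ → ℝ} (ha : ∀ n, 0 ≤ a n) (ha1 : 0 < a 1) {x y : ℝ} (hx : 0 ≤ x)
    (hxy : x < y) (hy : Summable fun n => a n * y ^ n) :
    ∑' n, a n * x ^ n < ∑' n, a n * y ^ n := by
  refine Summable.tsum_lt_tsum (i := 1) (fun n => ?_) ?_
    (summable_mul_pow_of_le ha hy hx hxy.le) hy
  · exact mul_le_mul_of_nonneg_left (pow_le_pow_left₀ hx hxy.le n) (ha n)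
  · simpa using mul_lt_mul_of_pos_left hxy ha1

lemma betaTilde_real (y : ℝ) : betaTilde y = ∑' j : ℕ, |magnusBeta j| * y ^ j := rfl

lemma continuousOn_betaTilde : ContinuousOn (betaTilde : ℝ → ℝ) (Set.Ico 0 (2 * Real.pi)) := by
  intro y hy
  obtain ⟨r, hyr, hr⟩ := exists_between hy.2
  have h1 : ContinuousOn (betaTilde : ℝ → ℝ) (Set.Icc 0 r) :=
    continuousOn_tsum_mul_pow (fun n => abs_nonneg _)
      (summable_abs_magnusBeta (hy.1.trans hyr.le) hr)
  refine (h1 y ⟨hy.1, hyr.le⟩).mono_of_mem_nhdsWithin ?_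
  refine mem_nhdsWithin.2 ⟨Set.Iio r, isOpen_Iio, hyr, fun x hx => ⟨hx.2.1, (hx.1 : x < r).le⟩⟩

lemma strictMonoOn_betaTilde : StrictMonoOn (betaTilde : ℝ → ℝ) (Set.Ico 0 (2 * Real.pi)) :=
  fun _ hx _ hy hxy => tsum_mul_pow_lt (fun n => abs_nonneg _) (by norm_num [magnusBeta_one]) hx.1
    hxy (summable_abs_magnusBeta hy.1 hy.2)

lemma betaTilde_zero : betaTilde (0 : ℝ) = 1 := by
  rw [betaTilde_real, tsum_eq_single 0 fun j hj => by simp [hj]]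
  simp [magnusBeta_zero]

lemma one_le_betaTilde {y : ℝ} (hy : y ∈ Set.Ico 0 (2 * Real.pi)) : 1 ≤ betaTilde y := by
  rw [← betaTilde_zero]
  exact strictMonoOn_betaTilde.monotoneOn ⟨le_rfl, by positivity⟩ hy hy.1

/-- The even coefficients of `β̃` are at least `2 (2π)⁻²ᵏ`, as `ζ(2k) ≥ 1`. -/
lemma two_le_abs_magnusBeta_mul {k : ℕ} (hk : k ≠ 0) :
    2 ≤ |magnusBeta (2 * k)| * (2 * Real.pi) ^ (2 * k) := by
  rw [abs_magnusBeta_even hk]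
  linarith [one_le_zeta hk]

lemma tendsto_betaTilde :
    Tendsto (betaTilde : ℝ → ℝ) (𝓝[<] (2 * Real.pi)) atTop := by
  refine tendsto_atTop.2 fun b => ?_
  obtain ⟨K, hK⟩ := exists_nat_gt b
  -- a partial sum with `K` even terms, each of value at least `2` at `2π`
  let P : ℝ → ℝ := fun y => ∑ k ∈ Finset.range K, |magnusBeta (2 * (k + 1))| * y ^ (2 * (k + 1))
  have hP : b < P (2 * Real.pi) := by
    refine hK.trans_le ?_
    have : ∑ k ∈ Finset.range K, (1 : ℝ) ≤ P (2 * Real.pi) :=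
      Finset.sum_le_sum fun k _ => one_le_two.trans (two_le_abs_magnusBeta_mul (Nat.succ_ne_zero k))
    simpa using this
  have hPc : ContinuousAt P (2 * Real.pi) := by
    have : Continuous P := by fun_prop
    exact this.continuousAt
  have h1 : ∀ᶠ y in 𝓝[<] (2 * Real.pi), b < P y :=
    (hPc.eventually (lt_mem_nhds hP)).filter_mono nhdsWithin_le_nhds
  have h2 : ∀ᶠ y in 𝓝[<] (2 * Real.pi), y ∈ Set.Ioo 0 (2 * Real.pi) :=
    Ioo_mem_nhdsLT (by positivity)
  filter_upwards [h1, h2] with y hy hy2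
  refine hy.le.trans ?_
  have h3 := (summable_abs_magnusBeta hy2.1.le hy2.2).sum_le_tsum
    ((Finset.range K).map ⟨fun k => 2 * (k + 1), fun a b h => by simpa using h⟩)
    fun j _ => mul_nonneg (abs_nonneg _) (pow_nonneg hy2.1.le j)
  rwa [Finset.sum_map] at h3

lemma betaTilde_two_pi : betaTilde (2 * Real.pi) = 0 := by
  refine tsum_eq_zero_of_not_summable fun h => ?_
  have h1 := (h.tendsto_atTop_zero.eventually (gt_mem_nhds (show (0 : ℝ) < 2 by norm_num)))
  obtain ⟨N, hN⟩ := eventually_atTop.1 h1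
  have h2 := hN (2 * (N + 1)) (by omega)
  exact absurd h2 (not_lt.2 (two_le_abs_magnusBeta_mul (Nat.succ_ne_zero N)))

lemma continuousOn_inv_betaTilde :
    ContinuousOn (fun y : ℝ => 1 / betaTilde y) (Set.Icc 0 (2 * Real.pi)) := by
  intro y hy
  rcases eq_or_lt_of_le hy.2 with rfl | h
  · -- the series diverges at `2π`, and the conventional value `1 / 0 = 0` is the limit
    have h1 : Tendsto (fun y : ℝ => 1 / betaTilde y) (𝓝[<] (2 * Real.pi)) (𝓝 0) := by
      simp only [one_div]
      exact tendsto_betaTilde.inv_tendsto_atTop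
    have h2 : ContinuousWithinAt (fun y : ℝ => 1 / betaTilde y) (Set.Iio (2 * Real.pi))
        (2 * Real.pi) := by
      rw [ContinuousWithinAt, betaTilde_two_pi, div_zero]; exact h1
    exact (continuousWithinAt_insert_self.2 h2).mono fun x hx => by
      rcases eq_or_lt_of_le hx.2 with h | h
      · exact Or.inl h
      · exact Or.inr h
  · have h1 := (continuousOn_betaTilde y ⟨hy.1, h⟩)
    have h2 : ContinuousWithinAt (betaTilde : ℝ → ℝ) (Set.Icc 0 (2 * Real.pi)) y := by
      refine h1.mono_of_mem_nhdsWithin ?_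
      exact mem_nhdsWithin.2 ⟨Set.Iio (2 * Real.pi), isOpen_Iio, h, fun x hx => ⟨hx.2.1, hx.1⟩⟩
    exact continuousWithinAt_const.div h2
      (by linarith [one_le_betaTilde (y := y) ⟨hy.1, h⟩])

/-- The closed form of `β̃` on `(0, 2π)`, without denominators. -/
lemma sin_mul_betaTilde {u : ℝ} (h0 : 0 < u) (h : u < Real.pi) :
    Real.sin u * betaTilde (2 * u) = (2 + u) * Real.sin u - u * Real.cos u := by
  have hn : ‖((2 * u : ℝ) : ℂ)‖ < 2 * Real.pi := by
    rw [Complex.norm_real, Real.norm_of_nonneg (by linarith)]; linarith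
  have h1 := hasSum_abs_magnusBeta hn
  have h2 : ((2 * u : ℝ) : ℂ) ≠ 0 := by exact_mod_cast (by linarith : (2 * u) ≠ 0)
  rw [if_neg h2] at h1
  have h3 : ((betaTilde (2 * u) : ℝ) : ℂ) = ∑' j : ℕ, ((|magnusBeta j| : ℝ) : ℂ) *
      ((2 * u : ℝ) : ℂ) ^ j := by
    rw [betaTilde_real, Complex.ofReal_tsum]
    simp
  have hs : Complex.sin (u : ℂ) ≠ 0 := by
    rw [← Complex.ofReal_sin]
    exact_mod_cast (Real.sin_pos_of_pos_of_lt_pi h0 h).ne'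
  have h4 : (Real.sin u * betaTilde (2 * u) : ℂ) =
      (2 + u) * Real.sin u - u * Real.cos u := by
    rw [h3, h1.tsum_eq, show ((2 * u : ℝ) : ℂ) / 2 = u by push_cast; ring, Complex.cot]
    push_cast
    field_simp
  exact_mod_cast h4

end Beta

/-! ### Partial sums of the majorant -/

section PsiAnalysis

open Filter Topology

open PowerSeries in
lemma sum_coeff_mul_le {p q : ℝ⟦X⟧} (hp : ∀ n, 0 ≤ coeff n p) (hq : ∀ n, 0 ≤ coeff n q) {x : ℝ}
    (hx : 0 ≤ x) (M : ℕ) :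
    ∑ k ∈ Finset.range M, coeff k (p * q) * x ^ k ≤
      (∑ k ∈ Finset.range M, coeff k p * x ^ k) * ∑ k ∈ Finset.range M, coeff k q * x ^ k := by
  classical
  let f : ℕ × ℕ → ℝ := fun a => coeff a.1 p * x ^ a.1 * (coeff a.2 q * x ^ a.2)
  have h1 : ∀ k, coeff k (p * q) * x ^ k =
      ∑ a ∈ Finset.HasAntidiagonal.antidiagonal k, f a := by
    intro k
    rw [coeff_mul, Finset.sum_mul]
    refine Finset.sum_congr rfl fun a ha => ?_
    rw [← Finset.HasAntidiagonal.mem_antidiagonal.1 ha, pow_add]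
    ring
  have hf : ∀ a, 0 ≤ f a := fun a =>
    mul_nonneg (mul_nonneg (hp _) (by positivity)) (mul_nonneg (hq _) (by positivity))
  rw [Finset.sum_mul_sum, ← Finset.sum_product', Finset.sum_congr rfl fun k _ => h1 k]
  have h2 : ∀ k ∈ Finset.range M, ∑ a ∈ Finset.HasAntidiagonal.antidiagonal k, f a =
      ∑ a ∈ (Finset.range M ×ˢ Finset.range M).filter (fun a => a.1 + a.2 = k), f a := by
    intro k hk
    refine Finset.sum_congr ?_ fun _ _ => rfl
    ext a
    simp only [Finset.HasAntidiagonal.mem_antidiagonal, Finset.mem_filter, Finset.mem_product,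
      Finset.mem_range] at hk ⊢
    omega
  rw [Finset.sum_congr rfl h2]
  exact Finset.sum_fiberwise_le_sum_of_sum_fiber_nonneg fun k _ =>
    Finset.sum_nonneg fun a _ => hf a

open PowerSeries in
lemma sum_coeff_psiSeries_pow_le_pow {x : ℝ} (hx : 0 ≤ x) (M s : ℕ) :
    ∑ k ∈ Finset.range M, coeff k (psiSeries ^ s) * x ^ k ≤
      (∑ k ∈ Finset.range M, psiCoeff k * x ^ k) ^ s := by
  induction s with
  | zero =>
    rw [pow_zero, pow_zero]
    rcases M with _ | M
    · simp
    · simp [coeff_one]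
  | succ s ih =>
    have h0 : ∀ n, coeff n psiSeries = psiCoeff n := fun n => by rw [psiSeries, coeff_mk]
    rw [pow_succ, pow_succ]
    refine (sum_coeff_mul_le (fun n => coeff_psiSeries_pow_nonneg n s)
      (fun n => by rw [h0]; exact psiCoeff_nonneg n) hx M).trans ?_
    simp only [h0]
    exact mul_le_mul_of_nonneg_right ih
      (Finset.sum_nonneg fun k _ => mul_nonneg (psiCoeff_nonneg k) (by positivity))

/-- The partial sums of `ψ`. -/
def psiPartial (N : ℕ) (x : ℝ) : ℝ := ∑ k ∈ Finset.range (N + 1), psiCoeff k * x ^ k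

lemma psiPartial_nonneg (N : ℕ) {x : ℝ} (hx : 0 ≤ x) : 0 ≤ psiPartial N x :=
  Finset.sum_nonneg fun k _ => mul_nonneg (psiCoeff_nonneg k) (by positivity)

lemma psiPartial_mono (N : ℕ) {x y : ℝ} (hx : 0 ≤ x) (hxy : x ≤ y) :
    psiPartial N x ≤ psiPartial N y :=
  Finset.sum_le_sum fun k _ => mul_le_mul_of_nonneg_left (pow_le_pow_left₀ hx hxy k)
    (psiCoeff_nonneg k)

lemma psiPartial_zero (N : ℕ) : psiPartial N 0 = 0 := by
  rw [psiPartial, Finset.sum_range_succ']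
  simp [psiCoeff_zero]

lemma hasDerivAt_psiPartial (N : ℕ) (x : ℝ) :
    HasDerivAt (psiPartial N)
      (∑ k ∈ Finset.range N, ((k : ℝ) + 1) * psiCoeff (k + 1) * x ^ k) x := by
  have h1 : psiPartial N =
      fun y => ∑ k ∈ Finset.range N, psiCoeff (k + 1) * y ^ (k + 1) := by
    funext y
    rw [psiPartial, Finset.sum_range_succ']
    simp [psiCoeff_zero]
  rw [h1]
  refine HasDerivAt.fun_sum fun k _ => ?_
  refine ((hasDerivAt_pow (k + 1) x).const_mul (psiCoeff (k + 1))).congr_deriv ?_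
  push_cast
  ring

/-- The partial sums of `ψ` are subsolutions of the differential equation `y' = β̃(y)`. -/
lemma deriv_psiPartial_le (N : ℕ) {x : ℝ} (hx : 0 ≤ x) (h : psiPartial N x < 2 * Real.pi) :
    ∑ k ∈ Finset.range N, ((k : ℝ) + 1) * psiCoeff (k + 1) * x ^ k ≤
      betaTilde (psiPartial N x) := by
  have h1 : ∀ k ∈ Finset.range N, ((k : ℝ) + 1) * psiCoeff (k + 1) * x ^ k =
      ∑ s ∈ Finset.range N,
        |magnusBeta s| * (PowerSeries.coeff k (psiSeries ^ s) * x ^ k) := by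
    intro k hk
    rw [psiCoeff_succ, Finset.sum_mul]
    have hk : k + 1 ≤ N := Finset.mem_range.1 hk
    rw [← Finset.sum_subset (Finset.range_mono hk)]
    · exact Finset.sum_congr rfl fun s _ => by ring
    · intro s _ hs
      rw [coeff_psiSeries_pow_of_lt (by simpa using hs)]
      simp
  rw [Finset.sum_congr rfl h1, Finset.sum_comm]
  refine le_trans (Finset.sum_le_sum fun s _ => ?_)
    ((summable_abs_magnusBeta (psiPartial_nonneg N hx) h).sum_le_tsum (Finset.range N)
      fun s _ => mul_nonneg (abs_nonneg _) (pow_nonneg (psiPartial_nonneg N hx) s))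
  rw [← Finset.mul_sum]
  refine mul_le_mul_of_nonneg_left ?_ (abs_nonneg _)
  refine le_trans (Finset.sum_le_sum_of_subset_of_nonneg (Finset.range_mono N.le_succ)
    fun k _ _ => mul_nonneg (coeff_psiSeries_pow_nonneg k s) (by positivity)) ?_
  exact sum_coeff_psiSeries_pow_le_pow hx (N + 1) s

/-! ### The time function of the differential equation -/

/-- The function `1 / β̃` on `[0, 2π]`, extended to a continuous function on the real line which is
constant outside this interval. -/
def betaRecip : ℝ → ℝ :=
  Set.IccExtend (show (0 : ℝ) ≤ 2 * Real.pi by positivity)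
    ((Set.Icc 0 (2 * Real.pi)).domRestrict fun y : ℝ => 1 / betaTilde y)

lemma continuous_betaRecip : Continuous betaRecip :=
  continuousOn_inv_betaTilde.domRestrict.Icc_extend'

lemma betaRecip_of_mem {y : ℝ} (hy : y ∈ Set.Icc 0 (2 * Real.pi)) :
    betaRecip y = 1 / betaTilde y := by
  rw [betaRecip, Set.IccExtend_of_mem _ _ hy]; rfl

/-- The time `∫₀ʸ du / β̃(u)` at which the solution of `ψ' = β̃(ψ)`, `ψ(0) = 0` attains the
value `y`. -/
def betaTime (y : ℝ) : ℝ := ∫ u in (0 : ℝ)..y, betaRecip u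

lemma hasDerivAt_betaTime (y : ℝ) : HasDerivAt betaTime (betaRecip y) y :=
  (continuous_betaRecip.integral_hasStrictDerivAt 0 y).hasDerivAt

lemma betaTime_zero : betaTime 0 = 0 := intervalIntegral.integral_same

lemma betaTime_two_pi : betaTime (2 * Real.pi) = standardDelta := by
  refine intervalIntegral.integral_congr fun y hy => ?_
  rw [Set.uIcc_of_le (by positivity)] at hy
  exact betaRecip_of_mem hy

lemma strictMonoOn_betaTime : StrictMonoOn betaTime (Set.Icc 0 (2 * Real.pi)) := by
  refine strictMonoOn_of_deriv_pos (convex_Icc _ _)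
    (fun y _ => (hasDerivAt_betaTime y).continuousAt.continuousWithinAt) fun y hy => ?_
  rw [interior_Icc] at hy
  rw [(hasDerivAt_betaTime y).deriv, betaRecip_of_mem ⟨hy.1.le, hy.2.le⟩]
  have := one_le_betaTilde ⟨hy.1.le, hy.2⟩
  positivity

lemma standardDelta_pos : 0 < standardDelta := by
  rw [← betaTime_two_pi, ← betaTime_zero]
  exact strictMonoOn_betaTime ⟨le_rfl, by positivity⟩ ⟨by positivity, le_rfl⟩ (by positivity)

/-- A subsolution of `y' = β̃(y)` which starts at `0` does not reach `2π` before the time `δ`. -/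
lemma psiPartial_lt_of_lt (N : ℕ) {x : ℝ} (hx : 0 ≤ x) (hxd : x < standardDelta) :
    psiPartial N x < 2 * Real.pi := by
  by_contra! h
  have hcont : Continuous (psiPartial N) :=
    continuous_iff_continuousAt.2 fun y => (hasDerivAt_psiPartial N y).continuousAt
  -- a point at which the partial sum attains the value `2π` is at least `δ`
  obtain ⟨x₀, hx₀, hS⟩ := intermediate_value_Icc hx hcont.continuousOn
    (show 2 * Real.pi ∈ Set.Icc (psiPartial N 0) (psiPartial N x) by
      rw [psiPartial_zero]; exact ⟨by positivity, h⟩)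
  have hd : ∀ y, HasDerivAt (fun y => y - betaTime (psiPartial N y))
      (1 - betaRecip (psiPartial N y) *
        ∑ k ∈ Finset.range N, ((k : ℝ) + 1) * psiCoeff (k + 1) * y ^ k) y := fun y =>
    (hasDerivAt_id y).sub ((hasDerivAt_betaTime _).comp y (hasDerivAt_psiPartial N y))
  have hmono : MonotoneOn (fun y => y - betaTime (psiPartial N y)) (Set.Icc 0 x₀) := by
    refine monotoneOn_of_deriv_nonneg (convex_Icc _ _)
      (fun y _ => (hd y).continuousAt.continuousWithinAt)
      (fun y _ => (hd y).differentiableAt.differentiableWithinAt) fun y hy => ?_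
    rw [interior_Icc] at hy
    rw [(hd y).deriv]
    have h0 := psiPartial_nonneg N hy.1.le
    have hle : psiPartial N y ≤ 2 * Real.pi := hS ▸ psiPartial_mono N hy.1.le hy.2.le
    rw [betaRecip_of_mem ⟨h0, hle⟩]
    rcases eq_or_lt_of_le hle with he | hlt
    · rw [he, betaTilde_two_pi]; simp
    · have h1 := one_le_betaTilde ⟨h0, hlt⟩
      rw [sub_nonneg, div_mul_eq_mul_div, one_mul, div_le_one (by linarith)]
      exact deriv_psiPartial_le N hy.1.le hlt
  have := hmono ⟨le_rfl, hx₀.1⟩ ⟨hx₀.1, le_rfl⟩ hx₀.1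
  simp only [psiPartial_zero, betaTime_zero, hS, betaTime_two_pi] at this
  linarith [hx₀.2]

lemma psiPartial_standardDelta_le (N : ℕ) : psiPartial N standardDelta ≤ 2 * Real.pi := by
  have h1 : Tendsto (psiPartial N) (𝓝[<] standardDelta) (𝓝 (psiPartial N standardDelta)) :=
    (hasDerivAt_psiPartial N standardDelta).continuousAt.tendsto.mono_left nhdsWithin_le_nhds
  refine le_of_tendsto h1 ?_
  filter_upwards [Ioo_mem_nhdsLT standardDelta_pos] with x hx
  exact (psiPartial_lt_of_lt N hx.1.le hx.2).le

lemma sum_range_psi_le (N : ℕ) :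
    ∑ k ∈ Finset.range N, psiCoeff k * standardDelta ^ k ≤ 2 * Real.pi :=
  (Finset.sum_le_sum_of_subset_of_nonneg (Finset.range_mono N.le_succ) fun k _ _ =>
    mul_nonneg (psiCoeff_nonneg k) (pow_nonneg standardDelta_pos.le k)).trans
    (psiPartial_standardDelta_le N)

lemma summable_psi_standardDelta : Summable fun k => psiCoeff k * standardDelta ^ k :=
  summable_of_sum_range_le
    (fun k => mul_nonneg (psiCoeff_nonneg k) (pow_nonneg standardDelta_pos.le k)) sum_range_psi_le

/-! ### The differential equation -/

lemma psiSum_zero {𝕜 : Type*} [RCLike 𝕜] : psiSum (0 : 𝕜) = 0 := by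
  rw [psiSum, tsum_eq_single 0 fun j hj => by simp [hj]]
  simp [psiCoeff_zero]

lemma psiCoeff_one : psiCoeff 1 = 1 := by
  have := psiCoeff_succ 0
  simpa [magnusBeta_zero] using this

lemma summable_psi {x : ℝ} (hx : x ∈ Set.Icc 0 standardDelta) :
    Summable fun k => psiCoeff k * x ^ k :=
  summable_mul_pow_of_le psiCoeff_nonneg summable_psi_standardDelta hx.1 hx.2

lemma psiSum_standardDelta_le : psiSum standardDelta ≤ 2 * Real.pi :=
  summable_psi_standardDelta.tsum_le_of_sum_range_le sum_range_psi_le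

lemma strictMonoOn_psiSum : StrictMonoOn (psiSum : ℝ → ℝ) (Set.Icc 0 standardDelta) :=
  fun _ hx _ hy hxy => tsum_mul_pow_lt psiCoeff_nonneg (by rw [psiCoeff_one]; norm_num) hx.1 hxy
    (summable_psi hy)

lemma psiSum_mem {x : ℝ} (hx : x ∈ Set.Ico 0 standardDelta) :
    psiSum x ∈ Set.Ico 0 (2 * Real.pi) := by
  refine ⟨tsum_nonneg fun k => mul_nonneg (psiCoeff_nonneg k) (pow_nonneg hx.1 k), ?_⟩
  exact (strictMonoOn_psiSum ⟨hx.1, hx.2.le⟩ ⟨standardDelta_pos.le, le_rfl⟩ hx.2).trans_le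
    psiSum_standardDelta_le

section RCLike

variable {𝕜 : Type*} [RCLike 𝕜]

lemma norm_ofReal_mul_pow {c : ℝ} (hc : 0 ≤ c) (z : 𝕜) (k : ℕ) :
    ‖(c : 𝕜) * z ^ k‖ = c * ‖z‖ ^ k := by
  rw [norm_mul, norm_pow, RCLike.norm_ofReal, abs_of_nonneg hc]

open PowerSeries in
lemma hasSum_psi_pow {z : 𝕜} (hz : ‖z‖ ≤ standardDelta) (s : ℕ) :
    (Summable fun k => ‖((coeff k (psiSeries ^ s) : ℝ) : 𝕜) * z ^ k‖) ∧
      HasSum (fun k => ((coeff k (psiSeries ^ s) : ℝ) : 𝕜) * z ^ k) (psiSum z ^ s) := by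
  have h1 : Summable fun k => ‖((psiCoeff k : ℝ) : 𝕜) * z ^ k‖ := by
    simp only [norm_ofReal_mul_pow (psiCoeff_nonneg _)]
    exact summable_psi ⟨norm_nonneg z, hz⟩
  induction s with
  | zero =>
    have h2 : ∀ k, ((coeff k (psiSeries ^ 0) : ℝ) : 𝕜) * z ^ k = if k = 0 then 1 else 0 := by
      intro k
      rw [pow_zero, coeff_one]
      split_ifs with h <;> simp [h]
    simp only [h2]
    rw [pow_zero]
    refine ⟨summable_of_ne_finset_zero (s := {0}) fun k hk => ?_, hasSum_ite_eq 0 1⟩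
    rw [if_neg (by simpa using hk), norm_zero]
  | succ s ih =>
    have h2 : ∀ k, ((coeff k (psiSeries ^ (s + 1)) : ℝ) : 𝕜) * z ^ k =
        ∑ p ∈ Finset.HasAntidiagonal.antidiagonal k,
          (((coeff p.1 (psiSeries ^ s) : ℝ) : 𝕜) * z ^ p.1) *
            (((psiCoeff p.2 : ℝ) : 𝕜) * z ^ p.2) := by
      intro k
      rw [pow_succ, coeff_mul, RCLike.ofReal_sum, Finset.sum_mul]
      refine Finset.sum_congr rfl fun p hp => ?_
      rw [← Finset.HasAntidiagonal.mem_antidiagonal.1 hp, pow_add,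
        show coeff p.2 psiSeries = psiCoeff p.2 by rw [psiSeries, coeff_mk], RCLike.ofReal_mul]
      ring
    simp only [h2]
    have h3 := summable_norm_sum_mul_antidiagonal_of_summable_norm ih.1 h1
    refine ⟨h3, ?_⟩
    rw [pow_succ, ← ih.2.tsum_eq, psiSum,
      tsum_mul_tsum_eq_tsum_sum_antidiagonal_of_summable_norm ih.1 h1]
    exact h3.of_norm.hasSum

lemma norm_psiSum_le {z : 𝕜} (hz : ‖z‖ ≤ standardDelta) : ‖psiSum z‖ ≤ psiSum ‖z‖ := by
  refine tsum_of_norm_bounded (summable_psi ⟨norm_nonneg z, hz⟩).hasSum fun k => ?_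
  rw [norm_ofReal_mul_pow (psiCoeff_nonneg k)]

/-- The termwise derivative of `ψ` is `β̃(ψ)`. -/
lemma hasSum_deriv_psi {z : 𝕜} (hz : ‖z‖ < standardDelta) :
    HasSum (fun k : ℕ => ((((k : ℝ) + 1) * psiCoeff (k + 1) : ℝ) : 𝕜) * z ^ k)
      (betaTilde (psiSum z)) := by
  let f : ℕ × ℕ → 𝕜 := fun p =>
    ((|magnusBeta p.1| : ℝ) : 𝕜) * (((PowerSeries.coeff p.2 (psiSeries ^ p.1) : ℝ) : 𝕜) * z ^ p.2)
  have hnorm : ∀ p, ‖f p‖ =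
      |magnusBeta p.1| * ‖((PowerSeries.coeff p.2 (psiSeries ^ p.1) : ℝ) : 𝕜) * z ^ p.2‖ := by
    intro p
    rw [norm_mul, RCLike.norm_ofReal, abs_abs]
  have hreal := fun s => hasSum_psi_pow (𝕜 := ℝ) (z := ‖z‖) (by simpa using hz.le) s
  have hsum : Summable fun p => ‖f p‖ := by
    rw [summable_prod_of_nonneg fun p => norm_nonneg _]
    simp only [hnorm, tsum_mul_left]
    refine ⟨fun s => (hasSum_psi_pow hz.le s).1.mul_left _, ?_⟩
    have h1 : ∀ s, ∑' k, ‖((PowerSeries.coeff k (psiSeries ^ s) : ℝ) : 𝕜) * z ^ k‖ =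
        psiSum ‖z‖ ^ s := by
      intro s
      simp only [norm_ofReal_mul_pow (coeff_psiSeries_pow_nonneg _ s)]
      exact (hreal s).2.tsum_eq
    simp only [h1]
    have h2 := psiSum_mem (x := ‖z‖) ⟨norm_nonneg z, hz⟩
    exact summable_abs_magnusBeta h2.1 h2.2
  have h3 : ∑' p, f p = betaTilde (psiSum z) := by
    rw [hsum.of_norm.tsum_prod]
    refine tsum_congr fun s => ?_
    simp only [f]
    rw [tsum_mul_left, (hasSum_psi_pow hz.le s).2.tsum_eq]
  have h4 : HasSum (f ∘ Prod.swap) (betaTilde (psiSum z)) := by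
    rw [← h3]
    exact (Equiv.prodComm ℕ ℕ).hasSum_iff.2 hsum.of_norm.hasSum
  refine h4.prod_fiberwise fun k => ?_
  have h5 : ((((k : ℝ) + 1) * psiCoeff (k + 1) : ℝ) : 𝕜) * z ^ k =
      ∑ s ∈ Finset.range (k + 1), (f ∘ Prod.swap) (k, s) := by
    rw [psiCoeff_succ, RCLike.ofReal_sum, Finset.sum_mul]
    refine Finset.sum_congr rfl fun s _ => ?_
    simp [f, mul_assoc]
  rw [h5]
  refine hasSum_sum_of_ne_finset_zero fun s hs => ?_
  simp [f, coeff_psiSeries_pow_of_lt (show k < s by simpa using hs)]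

/-- The differential equation `ψ' = β̃(ψ)`. -/
lemma hasDerivAt_psiSum {z : 𝕜} (hz : ‖z‖ < standardDelta) :
    HasDerivAt psiSum (betaTilde (psiSum z)) z := by
  obtain ⟨r, hzr, hr⟩ := exists_between hz
  have hr0 : 0 ≤ r := (norm_nonneg z).trans hzr.le
  have hu : Summable fun k : ℕ => ((k : ℝ) + 1) * psiCoeff (k + 1) * r ^ k := by
    have := (hasSum_deriv_psi (𝕜 := ℝ) (z := r)
      (by rwa [Real.norm_of_nonneg hr0])).summable
    simpa using this
  have h1 : ∀ y ∈ Metric.ball (0 : 𝕜) r, psiSum y =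
      ∑' k : ℕ, ((psiCoeff (k + 1) : ℝ) : 𝕜) * y ^ (k + 1) := by
    intro y hy
    have hy' : ‖y‖ ≤ standardDelta := (mem_ball_zero_iff.1 hy).le.trans hr.le
    have hs := (hasSum_psi_pow hy' 1).2.summable
    simp only [pow_one, psiSeries, PowerSeries.coeff_mk] at hs
    rw [psiSum, hs.tsum_eq_zero_add]
    simp [psiCoeff_zero]
  have h2 := hasDerivAt_tsum_of_isPreconnected (𝕜 := 𝕜) (y₀ := 0) (y := z)
    (g := fun (k : ℕ) (y : 𝕜) => ((psiCoeff (k + 1) : ℝ) : 𝕜) * y ^ (k + 1))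
    (g' := fun (k : ℕ) (y : 𝕜) => ((((k : ℝ) + 1) * psiCoeff (k + 1) : ℝ) : 𝕜) * y ^ k)
    hu (Metric.isOpen_ball (x := (0 : 𝕜)) (ε := r))
    (convex_ball (0 : 𝕜) r).isPreconnected (fun k y _ => ?_)
    (fun k y hy => ?_) (by simpa using (norm_nonneg z).trans_lt hzr)
    (by simp) (by simpa using hzr)
  · rw [(hasSum_deriv_psi hz).tsum_eq] at h2
    refine h2.congr_of_eventuallyEq ?_
    filter_upwards [Metric.isOpen_ball.mem_nhds (show z ∈ Metric.ball (0 : 𝕜) r by simpa using hzr)]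
      with y hy using h1 y hy
  · refine ((hasDerivAt_pow (k + 1) y).const_mul ((psiCoeff (k + 1) : ℝ) : 𝕜)).congr_deriv ?_
    push_cast
    ring
  · rw [norm_ofReal_mul_pow (mul_nonneg (by positivity) (psiCoeff_nonneg _))]
    exact mul_le_mul_of_nonneg_left
      (pow_le_pow_left₀ (norm_nonneg y) (mem_ball_zero_iff.1 hy).le k)
      (mul_nonneg (by positivity) (psiCoeff_nonneg _))

end RCLike

/-! ### Behaviour at the end of the interval of convergence -/

/-- Separation of variables: on `[0, δ)` the function `ψ` is the inverse of `betaTime`. -/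
lemma betaTime_psiSum {x : ℝ} (hx : x ∈ Set.Ico 0 standardDelta) : betaTime (psiSum x) = x := by
  have hd : ∀ y ∈ Set.Icc 0 x, HasDerivAt (fun y : ℝ => betaTime (psiSum y) - y) 0 y := by
    intro y hy
    have hy' : y ∈ Set.Ico 0 standardDelta := ⟨hy.1, hy.2.trans_lt hx.2⟩
    have h1 := ((hasDerivAt_betaTime (psiSum y)).comp y (hasDerivAt_psiSum (𝕜 := ℝ) (z := y)
      (by rw [Real.norm_of_nonneg hy.1]; exact hy'.2))).sub (hasDerivAt_id y)
    have h2 := psiSum_mem hy'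
    rw [betaRecip_of_mem ⟨h2.1, h2.2.le⟩, one_div, inv_mul_cancel₀
      (by linarith [one_le_betaTilde h2]), sub_self] at h1
    exact h1
  have h := constant_of_has_deriv_right_zero
    (fun y hy => (hd y hy).continuousAt.continuousWithinAt)
    (fun y hy => (hd y ⟨hy.1, hy.2.le⟩).hasDerivWithinAt) x ⟨hx.1, le_rfl⟩
  simp only [psiSum_zero, betaTime_zero, sub_zero] at h
  linarith

lemma tendsto_psiSum_left :
    Tendsto (psiSum : ℝ → ℝ) (𝓝[<] standardDelta) (𝓝 (psiSum standardDelta)) := by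
  have h := continuousOn_tsum_mul_pow psiCoeff_nonneg summable_psi_standardDelta standardDelta
    ⟨standardDelta_pos.le, le_rfl⟩
  refine Tendsto.mono_left h (nhdsWithin_le_iff.2 ?_)
  exact mem_of_superset (Ioo_mem_nhdsLT standardDelta_pos) fun x hx => ⟨hx.1.le, hx.2.le⟩

lemma psiSum_standardDelta : psiSum standardDelta = 2 * Real.pi := by
  have h0 : 0 ≤ psiSum standardDelta :=
    tsum_nonneg fun k => mul_nonneg (psiCoeff_nonneg k) (pow_nonneg standardDelta_pos.le k)
  refine strictMonoOn_betaTime.injOn ⟨h0, psiSum_standardDelta_le⟩ ⟨by positivity, le_rfl⟩ ?_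
  rw [betaTime_two_pi]
  have h1 : Tendsto (fun x : ℝ => betaTime (psiSum x)) (𝓝[<] standardDelta)
      (𝓝 (betaTime (psiSum standardDelta))) :=
    (hasDerivAt_betaTime _).continuousAt.tendsto.comp tendsto_psiSum_left
  have h2 : Tendsto (fun x : ℝ => betaTime (psiSum x)) (𝓝[<] standardDelta) (𝓝 standardDelta) := by
    refine (tendsto_id.mono_left nhdsWithin_le_nhds).congr' ?_
    filter_upwards [Ioo_mem_nhdsLT standardDelta_pos] with x hx
    exact (betaTime_psiSum ⟨hx.1.le, hx.2⟩).symm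
  exact tendsto_nhds_unique h1 h2

lemma deriv_psiSum {x : ℝ} (hx : x ∈ Set.Ico 0 standardDelta) :
    deriv (psiSum : ℝ → ℝ) x = betaTilde (psiSum x) :=
  (hasDerivAt_psiSum (𝕜 := ℝ) (by rw [Real.norm_of_nonneg hx.1]; exact hx.2)).deriv

lemma tendsto_deriv_psiSum :
    Tendsto (deriv (psiSum : ℝ → ℝ)) (𝓝[<] standardDelta) atTop := by
  have h1 : Tendsto (psiSum : ℝ → ℝ) (𝓝[<] standardDelta) (𝓝[<] (2 * Real.pi)) := by
    refine tendsto_nhdsWithin_iff.2 ⟨psiSum_standardDelta ▸ tendsto_psiSum_left, ?_⟩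
    filter_upwards [Ioo_mem_nhdsLT standardDelta_pos] with x hx
    exact (psiSum_mem ⟨hx.1.le, hx.2⟩).2
  refine (tendsto_betaTilde.comp h1).congr' ?_
  filter_upwards [Ioo_mem_nhdsLT standardDelta_pos] with x hx
  exact (deriv_psiSum ⟨hx.1.le, hx.2⟩).symm

lemma not_summable_deriv_psi :
    ¬ Summable fun k : ℕ => (k : ℝ) * psiCoeff k * standardDelta ^ (k - 1) := by
  intro h
  have h1 : Summable fun k : ℕ => ((k : ℝ) + 1) * psiCoeff (k + 1) * standardDelta ^ k := by
    simpa using (summable_nat_add_iff 1).2 h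
  obtain ⟨x, hx, hx2⟩ := ((tendsto_deriv_psiSum.eventually_gt_atTop
    (∑' k : ℕ, ((k : ℝ) + 1) * psiCoeff (k + 1) * standardDelta ^ k)).and
    (Ioo_mem_nhdsLT standardDelta_pos)).exists
  rw [deriv_psiSum ⟨hx2.1.le, hx2.2⟩] at hx
  have h2 := hasSum_deriv_psi (𝕜 := ℝ) (z := x)
    (by rw [Real.norm_of_nonneg hx2.1.le]; exact hx2.2)
  refine absurd hx (not_lt.2 (hasSum_le (fun k => ?_) h2 h1.hasSum))
  exact mul_le_mul_of_nonneg_left (pow_le_pow_left₀ hx2.1.le hx2.2.le k)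
    (mul_nonneg (by positivity) (psiCoeff_nonneg _))

/-- The derivative `k aᵏ⁻¹` is at most the difference quotient of the `k`-th power, which is at most
`bᵏ / (b - a)`. -/
lemma mul_pow_pred_mul_sub_le {a b : ℝ} (ha : 0 ≤ a) (hab : a ≤ b) (k : ℕ) :
    (k : ℝ) * a ^ (k - 1) * (b - a) ≤ b ^ k := by
  induction k with
  | zero => simp
  | succ k ih =>
    have h1 : (k : ℝ) * a ^ k = (k : ℝ) * a ^ (k - 1) * a := by
      rcases k with _ | k
      · simp
      · rw [Nat.add_sub_cancel, pow_succ, mul_assoc]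
    have h2 : a ^ k ≤ b ^ k := pow_le_pow_left₀ ha hab k
    calc ((k + 1 : ℕ) : ℝ) * a ^ (k + 1 - 1) * (b - a)
        = (k : ℝ) * a ^ (k - 1) * (b - a) * a + a ^ k * (b - a) := by
          rw [Nat.add_sub_cancel]; push_cast; linear_combination (b - a) * h1
      _ ≤ b ^ k * a + b ^ k * (b - a) :=
          add_le_add (mul_le_mul_of_nonneg_right ih ha)
            (mul_le_mul_of_nonneg_right h2 (sub_nonneg.2 hab))
      _ = b ^ (k + 1) := by ring

lemma ofReal_le_radius {a : ℕ → ℝ} (ha : ∀ n, 0 ≤ a n)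
    (h : Summable fun k => a k * standardDelta ^ k) :
    ENNReal.ofReal standardDelta ≤ (FormalMultilinearSeries.ofScalars ℝ a).radius := by
  refine FormalMultilinearSeries.le_radius_of_summable _ (r := standardDelta.toNNReal) ?_
  rw [Real.coe_toNNReal _ standardDelta_pos.le]
  refine h.congr fun k => ?_
  rw [FormalMultilinearSeries.ofScalars_norm, Real.norm_of_nonneg (ha k)]

lemma radius_psi :
    (FormalMultilinearSeries.ofScalars ℝ psiCoeff).radius = ENNReal.ofReal standardDelta := by
  refine le_antisymm ?_ (ofReal_le_radius psiCoeff_nonneg summable_psi_standardDelta)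
  by_contra! h
  obtain ⟨r, hr1, hr2⟩ := ENNReal.lt_iff_exists_nnreal_btwn.1 h
  have h1 := FormalMultilinearSeries.summable_norm_mul_pow _ hr2
  have hr : standardDelta < r := by
    rwa [← ENNReal.ofReal_coe_nnreal, ENNReal.ofReal_lt_ofReal_iff_of_nonneg
      standardDelta_pos.le] at hr1
  refine not_summable_deriv_psi ?_
  refine Summable.of_nonneg_of_le (fun k => mul_nonneg (mul_nonneg (by positivity)
    (psiCoeff_nonneg k)) (pow_nonneg standardDelta_pos.le _)) (fun k => ?_)
    (h1.mul_right (((r : ℝ) - standardDelta)⁻¹))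
  rw [FormalMultilinearSeries.ofScalars_norm, Real.norm_of_nonneg (psiCoeff_nonneg k),
    ← div_eq_mul_inv, le_div_iff₀ (sub_pos.2 hr)]
  have := mul_le_mul_of_nonneg_left (mul_pow_pred_mul_sub_le standardDelta_pos.le hr.le k)
    (psiCoeff_nonneg k)
  calc _ = psiCoeff k * ((k : ℝ) * standardDelta ^ (k - 1) * (r - standardDelta)) := by ring
    _ ≤ _ := this

end PsiAnalysis

/-! ### Polynomials with rational coefficients, computably -/

section ListPoly

/-- The value at `x` of the polynomial with the list of coefficients `l`. -/
def polyEval (l : List ℚ) (x : ℝ) : ℝ := l.foldr (fun a y => (a : ℝ) + x * y) 0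

/-- The sum of two polynomials. -/
def polyAdd : List ℚ → List ℚ → List ℚ
  | [], m => m
  | l, [] => l
  | a :: l, b :: m => (a + b) :: polyAdd l m

/-- The product of two polynomials. -/
def polyMul : List ℚ → List ℚ → List ℚ
  | [], _ => []
  | a :: l, m => polyAdd (m.map (a * ·)) (0 :: polyMul l m)

/-- The polynomial `v ↦ l (c + v)`. -/
def polyShift (c : ℚ) : List ℚ → List ℚ
  | [] => []
  | a :: l => polyAdd [a] (polyMul [c, 1] (polyShift c l))

/-- The polynomial `v ↦ l (v²)`. -/
def polySq : List ℚ → List ℚ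
  | [] => []
  | a :: l => a :: 0 :: polySq l

/-- The sum of the absolute values of the terms at `r`, a bound on the disc of radius `r`. -/
def polyNorm (r : ℚ) (l : List ℚ) : ℚ := l.foldr (fun a y => |a| + r * y) 0

/-- `x ↦ ∑ᵢ lᵢ xⁱ⁺¹ / (n + i)`. For `n = 1` this is the value at `x` of the primitive. -/
def polyPrim (x : ℚ) : ℕ → List ℚ → ℚ
  | _, [] => 0
  | n, a :: l => x * (a / n + polyPrim x (n + 1) l)

lemma polyEval_nil (x : ℝ) : polyEval [] x = 0 := rfl

lemma polyEval_cons (a : ℚ) (l : List ℚ) (x : ℝ) :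
    polyEval (a :: l) x = a + x * polyEval l x := rfl

lemma polyEval_add (l m : List ℚ) (x : ℝ) :
    polyEval (polyAdd l m) x = polyEval l x + polyEval m x := by
  fun_induction polyAdd l m with
  | case1 => simp [polyEval_nil]
  | case2 => simp [polyEval_nil]
  | case3 a l b m ih => simp only [polyEval_cons, ih]; push_cast; ring

lemma polyEval_map_mul (a : ℚ) (l : List ℚ) (x : ℝ) :
    polyEval (l.map (a * ·)) x = a * polyEval l x := by
  induction l with
  | nil => simp [polyEval_nil]
  | cons b l ih => simp only [List.map_cons, polyEval_cons, ih]; push_cast; ring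

lemma polyEval_mul (l m : List ℚ) (x : ℝ) :
    polyEval (polyMul l m) x = polyEval l x * polyEval m x := by
  induction l with
  | nil => simp [polyMul, polyEval_nil]
  | cons a l ih =>
    simp only [polyMul, polyEval_add, polyEval_map_mul, polyEval_cons, ih]
    push_cast
    ring

lemma polyEval_shift (c : ℚ) (l : List ℚ) (v : ℝ) :
    polyEval (polyShift c l) v = polyEval l (c + v) := by
  induction l with
  | nil => rfl
  | cons a l ih =>
    simp only [polyShift, polyEval_add, polyEval_mul, polyEval_cons, polyEval_nil, ih]
    push_cast
    ring

lemma polyEval_sq (l : List ℚ) (x : ℝ) : polyEval (polySq l) x = polyEval l (x ^ 2) := by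
  induction l with
  | nil => rfl
  | cons a l ih =>
    simp only [polySq, polyEval_cons, ih]
    push_cast
    ring

lemma abs_polyEval_le (r : ℚ) (l : List ℚ) {x : ℝ} (hx : |x| ≤ r) :
    |polyEval l x| ≤ (polyNorm r l : ℝ) := by
  induction l with
  | nil => simp [polyEval, polyNorm]
  | cons a l ih =>
    have h1 : polyNorm r (a :: l) = |a| + r * polyNorm r l := rfl
    rw [polyEval_cons, h1]
    push_cast
    refine (abs_add_le _ _).trans (add_le_add le_rfl ?_)
    rw [abs_mul]
    exact mul_le_mul hx ih (abs_nonneg _) ((abs_nonneg _).trans hx)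

lemma continuous_polyEval (l : List ℚ) : Continuous (polyEval l) := by
  induction l with
  | nil => exact continuous_const
  | cons a l ih => exact continuous_const.add (continuous_id.mul ih)

lemma polyEval_eq_sum (f : ℕ → ℚ) (M s : ℕ) (x : ℝ) :
    polyEval ((List.range' s M).map f) x =
      ∑ n ∈ Finset.range M, (f (s + n) : ℝ) * x ^ n := by
  induction M generalizing s with
  | zero => rfl
  | succ M ih =>
    rw [List.range'_succ, List.map_cons, polyEval_cons, ih, Finset.sum_range_succ',
      Finset.mul_sum]
    simp only [add_zero, pow_zero, mul_one, add_comm _ (f s : ℝ)]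
    congr 1
    refine Finset.sum_congr rfl fun n _ => ?_
    rw [show s + 1 + n = s + (n + 1) by omega]
    ring

lemma integral_pow_mul_polyEval (n : ℕ) (l : List ℚ) (x : ℚ) :
    ∫ v in (0 : ℝ)..x, v ^ n * polyEval l v = (x : ℝ) ^ n * polyPrim x (n + 1) l := by
  induction l generalizing n with
  | nil => simp [polyEval_nil, polyPrim]
  | cons a l ih =>
    have h1 : ∀ v : ℝ, v ^ n * polyEval (a :: l) v = a * v ^ n + v ^ (n + 1) * polyEval l v := by
      intro v
      rw [polyEval_cons]
      ring
    simp only [h1]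
    rw [intervalIntegral.integral_add, ih, intervalIntegral.integral_const_mul, integral_pow,
      polyPrim]
    · push_cast
      simp
      ring
    · exact Continuous.intervalIntegrable (by fun_prop) _ _
    · exact Continuous.intervalIntegrable ((continuous_pow _).mul (continuous_polyEval l)) _ _

lemma integral_polyEval (l : List ℚ) (x y : ℚ) :
    ∫ v in (x : ℝ)..y, polyEval l v = (polyPrim y 1 l - polyPrim x 1 l : ℚ) := by
  have h := fun z => integral_pow_mul_polyEval 0 l z
  simp only [pow_zero, one_mul, zero_add] at h
  have hi := fun a b => (continuous_polyEval l).intervalIntegrable (μ := MeasureTheory.volume) a b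
  rw [← intervalIntegral.integral_interval_sub_left (hi 0 y) (hi 0 x), h, h]
  push_cast
  ring

end ListPoly

/-! ### The numerical value of `δ` -/

section Numerics

/-- The Taylor polynomial of `sin u / u`. -/
def sincTaylor : List ℚ :=
  polySq ((List.range' 0 13).map fun n => (-1) ^ n / ((2 * n + 1)! : ℚ))

/-- The Taylor polynomial of `cos u`. -/
def cosTaylor : List ℚ :=
  polySq ((List.range' 0 13).map fun n => (-1) ^ n / ((2 * n)! : ℚ))

/-- The polynomial approximation of `(2 + u) sin u / u - cos u`, the denominator of
`1 / β̃(2u)` when the numerator is `sin u / u`. -/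
def denomTaylor : List ℚ :=
  polyAdd (polyMul [2, 1] sincTaylor) (cosTaylor.map ((-1) * ·))

/-- The Taylor polynomial of `exp (i u)`, split into real and imaginary part. -/
lemma sum_exp_I_mul (u : ℝ) (M : ℕ) :
    ∑ m ∈ Finset.range (2 * M), (u * Complex.I) ^ m / (m ! : ℂ) =
      ((∑ n ∈ Finset.range M, (-1) ^ n / ((2 * n)! : ℝ) * (u ^ 2) ^ n : ℝ) : ℂ) +
      ((u * ∑ n ∈ Finset.range M, (-1) ^ n / ((2 * n + 1)! : ℝ) * (u ^ 2) ^ n : ℝ) : ℂ) *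
        Complex.I := by
  induction M with
  | zero => simp
  | succ M ih =>
    rw [mul_add, mul_one, Finset.sum_range_succ, Finset.sum_range_succ, ih,
      Finset.sum_range_succ, Finset.sum_range_succ]
    have hI : Complex.I ^ (2 * M) = (-1) ^ M := by rw [pow_mul, Complex.I_sq]
    rw [pow_succ (u * Complex.I), mul_pow, hI, pow_mul]
    push_cast
    ring

lemma taylor_error {u : ℝ} (h0 : 0 < u) (h : u < Real.pi) :
    |Real.sin u / u - polyEval sincTaylor u| ≤ 1 / 10 ^ 13 ∧
      |Real.cos u - polyEval cosTaylor u| ≤ 1 / 10 ^ 13 := by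
  have hpi := Real.pi_lt_d2
  have hu : ‖(u * Complex.I : ℂ)‖ = u := by simp [abs_of_pos h0]
  have hexp := Complex.exp_bound' (x := u * Complex.I) (n := 2 * 13) (by
    rw [hu]; norm_num; linarith)
  rw [sum_exp_I_mul, hu, Complex.exp_mul_I, ← Complex.ofReal_cos, ← Complex.ofReal_sin] at hexp
  have hc : polyEval cosTaylor u =
      ∑ n ∈ Finset.range 13, (-1) ^ n / ((2 * n)! : ℝ) * (u ^ 2) ^ n := by
    rw [cosTaylor, polyEval_sq, polyEval_eq_sum]
    push_cast
    simp only [zero_add]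
  have hs : polyEval sincTaylor u =
      ∑ n ∈ Finset.range 13, (-1) ^ n / ((2 * n + 1)! : ℝ) * (u ^ 2) ^ n := by
    rw [sincTaylor, polyEval_sq, polyEval_eq_sum]
    push_cast
    simp only [zero_add]
  rw [← hc, ← hs] at hexp
  have hpow : u ^ 25 ≤ 3.15 ^ 25 := pow_le_pow_left₀ h0.le (by linarith) 25
  have hfac : ((2 * 13)! : ℝ) = 403291461126605635584000000 := by norm_num [Nat.factorial]
  rw [hfac] at hexp
  have hb : u ^ (2 * 13) / 403291461126605635584000000 * 2 ≤ u * (2 / 10 ^ 14) := by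
    rw [show u ^ (2 * 13) = u * u ^ 25 by ring]
    have : u * u ^ 25 ≤ u * 3.15 ^ 25 := mul_le_mul_of_nonneg_left hpow h0.le
    norm_num at this ⊢
    linarith
  have hexp := hexp.trans hb
  have hre := (Complex.abs_re_le_norm _).trans hexp
  have him := (Complex.abs_im_le_norm _).trans hexp
  simp only [Complex.add_re, Complex.sub_re, Complex.mul_re, Complex.ofReal_re, Complex.I_re,
    Complex.ofReal_im, Complex.I_im, Complex.add_im, Complex.sub_im, Complex.mul_im] at hre him
  constructor
  · have h1 : Real.sin u / u - polyEval sincTaylor u =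
        (Real.sin u - u * polyEval sincTaylor u) / u := by field_simp
    rw [h1, abs_div, abs_of_pos h0, div_le_iff₀ h0]
    have h2 : |Real.sin u - u * polyEval sincTaylor u| ≤ u * (2 / 10 ^ 14) := by
      refine le_of_eq_of_le (congrArg _ ?_) him
      ring
    refine h2.trans ?_
    norm_num
    linarith
  · have h2 : |Real.cos u - polyEval cosTaylor u| ≤ u * (2 / 10 ^ 14) := by
      refine le_of_eq_of_le (congrArg _ ?_) hre
      ring
    refine h2.trans ?_
    norm_num
    linarith

/-- A polynomial `p` approximates `1 / β̃(2u)` near `c` if `p` times the denominator is close to the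
numerator and the denominator is bounded below. -/
lemma abs_inv_betaTilde_sub_le (c r : ℚ) (p : List ℚ)
    (h1 : polyNorm r (polyAdd (polyMul (polyShift c denomTaylor) p)
      ((polyShift c sincTaylor).map ((-1) * ·))) ≤ 6 / 10 ^ 11)
    (h2 : polyNorm r (polyAdd (polyShift c denomTaylor) [-2]) ≤ 11 / 10)
    (h3 : polyNorm r p ≤ 2) {u : ℝ} (h0 : 0 < u) (h : u < Real.pi) (hu : |u - c| ≤ r) :
    |1 / betaTilde (2 * u) - polyEval p (u - c)| ≤ 1 / 10 ^ 10 := by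
  obtain ⟨hs, hc⟩ := taylor_error h0 h
  have hsin : 0 < Real.sin u := Real.sin_pos_of_pos_of_lt_pi h0 h
  have e1 := (abs_polyEval_le r _ hu).trans (by exact_mod_cast h1 : _ ≤ ((6 / 10 ^ 11 : ℚ) : ℝ))
  have e2 := (abs_polyEval_le r _ hu).trans (by exact_mod_cast h2 : _ ≤ ((11 / 10 : ℚ) : ℝ))
  have e3 := (abs_polyEval_le r _ hu).trans (by exact_mod_cast h3 : _ ≤ ((2 : ℚ) : ℝ))
  have hcu : (c : ℝ) + (u - c) = u := by ring
  simp only [polyEval_add, polyEval_mul, polyEval_map_mul, polyEval_shift, hcu, polyEval_cons,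
    polyEval_nil] at e1 e2
  have hD : polyEval denomTaylor u = (2 + u) * polyEval sincTaylor u - polyEval cosTaylor u := by
    rw [denomTaylor, polyEval_add, polyEval_mul, polyEval_map_mul, polyEval_cons, polyEval_cons,
      polyEval_nil]
    push_cast
    ring
  set s := Real.sin u / u with hsdef
  set D := (2 + u) * s - Real.cos u with hDdef
  set P := polyEval p (u - c)
  set S := polyEval sincTaylor u
  set C := polyEval cosTaylor u
  have hpi := Real.pi_lt_d2
  have hDD : |D - polyEval denomTaylor u| ≤ 7 / 10 ^ 13 := by
    rw [hD, hDdef, show (2 + u) * s - Real.cos u - ((2 + u) * S - C) =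
      (2 + u) * (s - S) - (Real.cos u - C) by ring]
    refine (abs_sub _ _).trans ?_
    rw [abs_mul, abs_of_pos (by linarith : 0 < 2 + u)]
    have : (2 + u) * |s - S| ≤ 6 * (1 / 10 ^ 13) :=
      mul_le_mul (by linarith) hs (abs_nonneg _) (by norm_num)
    linarith
  have hDpos : 8 / 10 ≤ D := by
    have a1 := abs_le.1 hDD
    have a2 := abs_le.1 e2
    push_cast at a2
    linarith [a1.1, a2.1]
  have hbeta : 1 / betaTilde (2 * u) = s / D := by
    have h4 := sin_mul_betaTilde h0 h
    have h5 : s * betaTilde (2 * u) = D := by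
      rw [hDdef, hsdef, div_mul_eq_mul_div, h4]
      field_simp
    have hs0 : s ≠ 0 := (div_pos hsin h0).ne'
    rw [← h5, div_mul_cancel_left₀ hs0, one_div]
  have hDP : |D * P - s| ≤ 8 / 10 ^ 11 := by
    rw [show D * P - s = (polyEval denomTaylor u * P + (-1 : ℚ) * S) +
      ((D - polyEval denomTaylor u) * P - (s - S)) by push_cast; ring]
    refine (abs_add_le _ _).trans ?_
    have b1 : |(D - polyEval denomTaylor u) * P| ≤ 7 / 10 ^ 13 * 2 := by
      rw [abs_mul]
      exact mul_le_mul hDD (by exact_mod_cast e3) (abs_nonneg _) (by norm_num)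
    have b2 := abs_sub ((D - polyEval denomTaylor u) * P) (s - S)
    push_cast at e1 ⊢
    linarith
  rw [hbeta, show s / D - P = -(D * P - s) / D by field_simp; ring, abs_div, abs_neg,
    abs_of_pos (by linarith : 0 < D), div_le_iff₀ (by linarith)]
  linarith

lemma intervalIntegrable_inv_betaTilde_two_mul {a b : ℝ} (ha : 0 ≤ a) (hab : a ≤ b)
    (hb : b ≤ Real.pi) :
    IntervalIntegrable (fun u : ℝ => 1 / betaTilde (2 * u)) MeasureTheory.volume a b := by
  refine ContinuousOn.intervalIntegrable ?_
  rw [Set.uIcc_of_le hab]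
  refine continuousOn_inv_betaTilde.comp (by fun_prop) fun u hu => ?_
  exact ⟨by linarith [hu.1], by linarith [hu.2]⟩

/-- The integral of `1 / β̃(2u)` over `[c - r, c + r]`, up to `10⁻¹⁰` times the length of the
interval, is that of a polynomial which passes the tests of `abs_inv_betaTilde_sub_le`. -/
lemma abs_integral_sub_le (c r : ℚ) (p : List ℚ)
    (h1 : polyNorm r (polyAdd (polyMul (polyShift c denomTaylor) p)
      ((polyShift c sincTaylor).map ((-1) * ·))) ≤ 6 / 10 ^ 11)
    (h2 : polyNorm r (polyAdd (polyShift c denomTaylor) [-2]) ≤ 11 / 10)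
    (h3 : polyNorm r p ≤ 2) (hr : 0 ≤ r) {a b : ℝ} (ha : a = c - r) (hb : b = c + r) (h0 : 0 ≤ a)
    (hpi : b < Real.pi) :
    |(∫ u in a..b, 1 / betaTilde (2 * u)) - (polyPrim r 1 p - polyPrim (-r) 1 p : ℚ)| ≤
      (b - a) / 10 ^ 10 := by
  have hr' : (0 : ℝ) ≤ r := by exact_mod_cast hr
  have hab : a ≤ b := by linarith
  have h4 : ∫ u in a..b, polyEval p (u - c) = (polyPrim r 1 p - polyPrim (-r) 1 p : ℚ) := by
    rw [intervalIntegral.integral_comp_sub_right (fun v => polyEval p v), ← integral_polyEval]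
    congr 1
    · rw [ha]; push_cast; ring
    · rw [hb]; ring
  have h5 := intervalIntegrable_inv_betaTilde_two_mul h0 hab hpi.le
  have h6 : IntervalIntegrable (fun u : ℝ => polyEval p (u - c)) MeasureTheory.volume a b :=
    ((continuous_polyEval p).comp (by fun_prop)).intervalIntegrable _ _
  rw [← h4, ← intervalIntegral.integral_sub h5 h6]
  have h7 := intervalIntegral.norm_integral_le_of_norm_le_const (a := a) (b := b)
    (C := 1 / 10 ^ 10) (f := fun u : ℝ => 1 / betaTilde (2 * u) - polyEval p (u - c))
    fun u hu => by
      rw [Set.uIoc_of_le hab] at hu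
      refine abs_inv_betaTilde_sub_le c r p h1 h2 h3 (h0.trans_lt hu.1) (hu.2.trans_lt hpi) ?_
      rw [abs_le]
      exact ⟨by linarith [hu.1], by linarith [hu.2]⟩
  rw [Real.norm_eq_abs, abs_of_nonneg (sub_nonneg.2 hab)] at h7
  exact h7.trans (le_of_eq (by ring))

/-- Division by `10¹²`. -/
def scaled (l : List ℤ) : List ℚ := l.map fun n => (n : ℚ) / 10 ^ 12

/-- An approximation of `v ↦ 1 / β̃(2 (c + v))` on `|v| ≤ 3/5`, `c = 3/5`. -/
def approxLeft : List ℚ := scaled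
  [580388970642, -478408787313, 264410113118, -132226016677, 55361884517, -19419838118,
    4284783220, 678202407, -1660797590, 1345752061, -831592821, 435734235, -198607875, 76824315,
    -22577014, 2211276, 3378174, -3608234, 2481211, -1399266]

/-- An approximation of `v ↦ 1 / β̃(2 (c + v))` on `|v| ≤ 3/5`, `c = 9/5`. -/
def approxMid : List ℚ := scaled
  [236969836591, -175836015921, 46396809887, -27182915192, 3734710711, -3870714222, -223603312,
    -637714874, -190687139, -134636096, -62624939, -33802973, -17661234, -9070921, -4808463,
    -2471849, -1302205, -674080, -353030, -183543]

/-- An approximation of `v ↦ 1 / β̃(2 (c + v))` for `2.4 ≤ c + v ≤ 3.1415926535`,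
`c = 2.77079632675`. -/
def approxRight : List ℚ := scaled
  [84049825935, -174309429634, -75746810052, -110466885100, -107745145049, -115998881569,
    -121852827524, -128768617995, -135892164584, -143454240294, -151427150971, -159845420892,
    -168731225739, -178111086019, -188012361438, -198464055838, -209496764558, -221142786631,
    -233436216491, -246413043795, -260111258938, -274570964199, -289834491168, -305946524665,
    -322954233560, -340907408864]

/-- The substitution `y = 2u`. -/
lemma standardDelta_eq : standardDelta = 2 * ∫ u in (0 : ℝ)..Real.pi, 1 / betaTilde (2 * u) := by
  rw [intervalIntegral.integral_comp_mul_left (fun y : ℝ => 1 / betaTilde y) two_ne_zero,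
    smul_eq_mul, mul_zero, mul_inv_cancel_left₀ two_ne_zero, standardDelta]

lemma standardDelta_bounds : 2.1737374 ≤ standardDelta ∧ standardDelta < 2.1737375 := by
  have hpi1 : (3.1415926535 : ℝ) < Real.pi := by
    have := Real.pi_gt_d20; norm_num at this ⊢; linarith
  have hpi2 : Real.pi < 3.14159265359 := by
    have := Real.pi_lt_d20; norm_num at this ⊢; linarith
  have hL := abs_integral_sub_le (3 / 5) (3 / 5) approxLeft (by decide +kernel)
    (by decide +kernel) (by decide +kernel) (by norm_num) (a := 0) (b := 1.2) (by norm_num)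
    (by norm_num) le_rfl (by linarith)
  have hM := abs_integral_sub_le (9 / 5) (3 / 5) approxMid (by decide +kernel)
    (by decide +kernel) (by decide +kernel) (by norm_num) (a := 1.2) (b := 2.4) (by norm_num)
    (by norm_num) (by norm_num) (by linarith)
  have hR := abs_integral_sub_le (11083185307 / 4000000000) (1483185307 / 4000000000) approxRight
    (by decide +kernel) (by decide +kernel) (by decide +kernel) (by norm_num)
    (a := 2.4) (b := 3.1415926535) (by norm_num) (by norm_num) (by norm_num) hpi1
  -- on the short interval that is left the integrand lies between `0` and `1`
  have hT : |∫ u in (3.1415926535 : ℝ)..Real.pi, 1 / betaTilde (2 * u)| ≤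
      1 * |Real.pi - 3.1415926535| := by
    refine intervalIntegral.norm_integral_le_of_norm_le_const
      (f := fun u : ℝ => 1 / betaTilde (2 * u)) fun u hu => ?_
    rw [Set.uIoc_of_le hpi1.le] at hu
    have hu0 : 0 ≤ 2 * u := by linarith [hu.1]
    rcases eq_or_lt_of_le hu.2 with rfl | hlt
    · rw [betaTilde_two_pi]; simp
    · have h1 := one_le_betaTilde (y := 2 * u) ⟨hu0, by linarith⟩
      rw [Real.norm_of_nonneg (by positivity), div_le_one (by linarith)]
      exact h1
  -- the approximate value of the integral is `2.17373740...`, with a total error below `10⁻⁹`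
  have hlow : (2173737401 / 10 ^ 9 : ℚ) ≤
      2 * ((polyPrim (3 / 5) 1 approxLeft - polyPrim (-(3 / 5)) 1 approxLeft) +
      (polyPrim (3 / 5) 1 approxMid - polyPrim (-(3 / 5)) 1 approxMid) +
      (polyPrim (1483185307 / 4000000000) 1 approxRight -
        polyPrim (-(1483185307 / 4000000000)) 1 approxRight)) := by decide +kernel
  have hupp : 2 * ((polyPrim (3 / 5) 1 approxLeft - polyPrim (-(3 / 5)) 1 approxLeft) +
      (polyPrim (3 / 5) 1 approxMid - polyPrim (-(3 / 5)) 1 approxMid) +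
      (polyPrim (1483185307 / 4000000000) 1 approxRight -
        polyPrim (-(1483185307 / 4000000000)) 1 approxRight)) ≤
      (2173737410 / 10 ^ 9 : ℚ) := by decide +kernel
  have hlow' := (Rat.cast_le (K := ℝ)).2 hlow
  have hupp' := (Rat.cast_le (K := ℝ)).2 hupp
  rw [abs_of_pos (sub_pos.2 hpi1)] at hT
  rw [standardDelta_eq, ← intervalIntegral.integral_add_adjacent_intervals
    (intervalIntegrable_inv_betaTilde_two_mul le_rfl (b := 3.1415926535) (by norm_num) hpi1.le)
    (intervalIntegrable_inv_betaTilde_two_mul (by norm_num) hpi1.le le_rfl),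
    ← intervalIntegral.integral_add_adjacent_intervals
    (intervalIntegrable_inv_betaTilde_two_mul le_rfl (b := 2.4) (by norm_num) (by linarith))
    (intervalIntegrable_inv_betaTilde_two_mul (by norm_num) (by norm_num) hpi1.le),
    ← intervalIntegral.integral_add_adjacent_intervals
    (intervalIntegrable_inv_betaTilde_two_mul le_rfl (b := 1.2) (by norm_num) (by linarith))
    (intervalIntegrable_inv_betaTilde_two_mul (by norm_num) (by norm_num) (by linarith))]
  rw [abs_le] at hL hM hR hT
  push_cast at hL hM hR hlow' hupp'
  norm_num at hL hM hR hT hlow' hupp' hpi2 ⊢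
  constructor <;> linarith [hL.1, hL.2, hM.1, hM.2, hR.1, hR.2, hT.1, hT.2]

end Numerics
end

theorem mainTheorem7 :
    -- the closed form of the series of the absolute values of the Bernoulli coefficients
    (∀ z : ℂ, ‖z‖ < 2 * Real.pi →
      HasSum (fun j : ℕ => ((|magnusBeta j| : ℝ) : ℂ) * z ^ j)
        (if z = 0 then 1 else 2 + z / 2 - z / 2 * Complex.cot (z / 2))) ∧
    -- the formal initial value problem
    (PowerSeries.constantCoeff (PowerSeries.mk psiCoeff) = 0 ∧
      PowerSeries.derivative ℝ (PowerSeries.mk psiCoeff) =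
        (PowerSeries.mk fun j => |magnusBeta j|).subst (PowerSeries.mk psiCoeff)) ∧
    -- the constant `δ`
    (IntervalIntegrable (fun y : ℝ => 1 / betaTilde y) MeasureTheory.volume 0 (2 * Real.pi) ∧
      2.1737374 ≤ standardDelta ∧ standardDelta < 2.1737375) ∧
    -- the convergence radius of `ψ`, and the analytic initial value problem
    (FormalMultilinearSeries.ofScalars ℝ psiCoeff).radius = ENNReal.ofReal standardDelta ∧
    (psiSum (0 : ℂ) = 0 ∧
      ∀ z : ℂ, ‖z‖ < standardDelta →
        ‖psiSum z‖ < 2 * Real.pi ∧ HasDerivAt psiSum (betaTilde (psiSum z)) z) ∧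
    -- the behaviour of `ψ` and `ψ'` as `x ↗ δ`
    (StrictMonoOn (psiSum : ℝ → ℝ) (Set.Ico 0 standardDelta) ∧
      Filter.Tendsto (psiSum : ℝ → ℝ) (nhdsWithin standardDelta (Set.Iio standardDelta))
        (nhds (2 * Real.pi)) ∧
      StrictMonoOn (deriv (psiSum : ℝ → ℝ)) (Set.Ico 0 standardDelta) ∧
      Filter.Tendsto (deriv (psiSum : ℝ → ℝ)) (nhdsWithin standardDelta (Set.Iio standardDelta))
        Filter.atTop ∧
      HasSum (fun k : ℕ => psiCoeff k * standardDelta ^ k) (2 * Real.pi) ∧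
      ¬ Summable (fun k : ℕ => (k : ℝ) * psiCoeff k * standardDelta ^ (k - 1))) ∧
    -- the Magnus commutators are Lie polynomials, and `ψ` majorizes `Θ^Lie` coefficientwise
    (∀ k : ℕ, freeLieToFreeAlgebra k (magnusLie k) = magnusCommutator k ∧
      (magnusPresentations k).Nonempty ∧ 0 ≤ thetaLie k ∧ thetaLie k ≤ psiCoeff k) ∧
    -- the standard estimate
    (∀ x ∈ Set.Icc 0 standardDelta, Summable (fun k : ℕ => thetaLie k * x ^ k) ∧
      ∑' k : ℕ, thetaLie k * x ^ k ≤ psiSum x) ∧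
    ENNReal.ofReal standardDelta ≤ radiusLie := by
  refine ⟨fun z hz => hasSum_abs_magnusBeta hz, ⟨by simp [psiCoeff_zero], derivative_psiSeries⟩,
    ⟨?_, standardDelta_bounds⟩, radius_psi, ⟨psiSum_zero, fun z hz => ⟨?_, hasDerivAt_psiSum hz⟩⟩,
    ⟨strictMonoOn_psiSum.mono Set.Ico_subset_Icc_self, psiSum_standardDelta ▸ tendsto_psiSum_left,
      ?_, tendsto_deriv_psiSum, psiSum_standardDelta ▸ summable_psi_standardDelta.hasSum,
      not_summable_deriv_psi⟩,
    fun k => ⟨magnusLie_spec k, ?_, thetaLie_nonneg k, thetaLie_le_psiCoeff k⟩, fun x hx => ?_,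
    ofReal_le_radius thetaLie_nonneg ?_⟩
  · refine ContinuousOn.intervalIntegrable ?_
    rw [Set.uIcc_of_le (by positivity)]
    exact continuousOn_inv_betaTilde
  · exact (norm_psiSum_le hz.le).trans_lt (psiSum_mem ⟨norm_nonneg z, hz⟩).2
  · intro x hx y hy hxy
    rw [deriv_psiSum hx, deriv_psiSum hy]
    exact strictMonoOn_betaTilde (psiSum_mem hx) (psiSum_mem hy)
      (strictMonoOn_psiSum ⟨hx.1, hx.2.le⟩ ⟨hy.1, hy.2.le⟩ hxy)
  · obtain ⟨θ, hθ, -⟩ := exists_magnusPresentation k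
    exact ⟨θ, hθ⟩
  · have hle : ∀ k, thetaLie k * x ^ k ≤ psiCoeff k * x ^ k := fun k =>
      mul_le_mul_of_nonneg_right (thetaLie_le_psiCoeff k) (pow_nonneg hx.1 k)
    have hs := Summable.of_nonneg_of_le
      (fun k => mul_nonneg (thetaLie_nonneg k) (pow_nonneg hx.1 k)) hle (summable_psi hx)
    exact ⟨hs, hs.tsum_le_tsum hle (summable_psi hx)⟩
  · exact Summable.of_nonneg_of_le
      (fun k => mul_nonneg (thetaLie_nonneg k) (pow_nonneg standardDelta_pos.le k))
      (fun k => mul_le_mul_of_nonneg_right (thetaLie_le_psiCoeff k)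
        (pow_nonneg standardDelta_pos.le k)) summable_psi_standardDelta
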